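/- A convex polyhedron is the convex hull of a finite set of points of $\mathbb R^3$ that has nonempty interior; its vertices, edges and faces are its faces of dimension $0$, $1$ and $2$. Two convex polyhedra $\Gamma$ and $\Gamma^\perp$ are dual if there are a bijection $\varphi$ from the vertices of $\Gamma$ to the faces of $\Gamma^\perp$ and a bijection $\psi$ from the faces of $\Gamma$ to the vertices of $\Gamma^\perp$ such that a vertex $v$ lies on a face $F$ of $\Gamma$ if and only if the vertex $\psi(F)$ lies on the face $\varphi(v)$ of $\Gamma^\perp$. For a convex polyhedron $\Gamma$ with $e$ edges, labelled arbitrarily by $1,\dots,e$, the code $\mathcal C(\Gamma)\subseteq\mathbb F_2^e$ generated by $\Gamma$ is the set of all $c\in\mathbb F_2^e$ such that, for every vertex $v$ of $\Gamma$, the entries of $c$ at the edges containing $v$ sum to $0$. The dual code of $\mathcal C\subseteq\mathbb F_2^e$ is $\mathcal C^\perp=\{y\in\mathbb F_2^e : \sum_i x_iy_i=0 \text{ for all } x\in\mathcal C\}$, and two binary codes are isomorphic if one is obtained from the other by a bijective relabelling of the coordinates (in particular they have the same length). Corollary. Let $\Gamma$ and $\Gamma^\perp$ be dual convex polyhedra,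 with arbitrary labellings of their edges. Then the dual code $\mathcal C(\Gamma)^\perp$ of the code generated by $\Gamma$ is isomorphic to the code $\mathcal C(\Gamma^\perp)$ generated by $\Gamma^\perp$. -/

import Mathlib

/-- Euclidean three-dimensional space. -/
abbrev Space3 : Type := EuclideanSpace ℝ (Fin 3)

/-- A convex polyhedron: the convex hull of finitely many points of three-dimensional space
which has an interior point (so it is bounded and is not contained in a plane). -/
structure ConvexPolyhedron where
  carrier : Set Space3
  exists_hull : ∃ S : Set Space3, S.Finite ∧ carrier = convexHull ℝ S
  nonempty_interior : (interior carrier).Nonempty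

namespace ConvexPolyhedron

/-- `F` is a `k`-dimensional face of `P`: a nonempty set on which some linear functional attains
its maximum over `P`, whose affine span has dimension `k`. -/
def IsFace (P : ConvexPolyhedron) (k : ℕ) (F : Set Space3) : Prop :=
  F.Nonempty ∧ IsExposed ℝ P.carrier F ∧ Module.finrank ℝ (vectorSpan ℝ F) = k

/-- The vertices of `P`, each regarded as a one-point set. -/
def Vertex (P : ConvexPolyhedron) : Type := {F : Set Space3 // P.IsFace 0 F}

/-- The edges of `P`. -/
def Edge (P : ConvexPolyhedron) : Type := {F : Set Space3 // P.IsFace 1 F}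

/-- The two-dimensional faces of `P` (the faces of a polyhedron in the everyday sense). -/
def Facet (P : ConvexPolyhedron) : Type := {F : Set Space3 // P.IsFace 2 F}

/-- `P` and `Q` are dual: the vertices of each correspond bijectively to the faces of the other,
and a vertex of `P` lies on a face of `P` exactly when the corresponding face of `Q` contains the
corresponding vertex of `Q`. -/
def IsDual (P Q : ConvexPolyhedron) : Prop :=
  ∃ (φ : P.Vertex ≃ Q.Facet) (ψ : P.Facet ≃ Q.Vertex),
    ∀ (v : P.Vertex) (F : P.Facet), v.1 ⊆ F.1 ↔ (ψ F).1 ⊆ (φ v).1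

open Classical in
/-- The code generated by `P`, for a labelling `l` of its edges: all binary words for which the
entries at the edges meeting at any one vertex sum to zero. -/
def code (P : ConvexPolyhedron) {n : ℕ} (l : Fin n ≃ P.Edge) :
    Submodule (ZMod 2) (Fin n → ZMod 2) where
  carrier := {c | ∀ v : P.Vertex, ∑ i with v.1 ⊆ (l i).1, c i = 0}
  zero_mem' := by intro v; simp
  add_mem' := by
    intro a b ha hb v
    simp [Finset.sum_add_distrib, ha v, hb v]
  smul_mem' := by
    intro r a ha v
    simp [← Finset.mul_sum, ha v]

/-- Every polyhedron has finitely many edges, hence a labelling of them. -/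
theorem exists_labelling (P : ConvexPolyhedron) : ∃ n : ℕ, Nonempty (Fin n ≃ P.Edge) := by
  obtain ⟨S, hS, hP⟩ := P.exists_hull
  have hc : IsCompact P.carrier := hP ▸ hS.isCompact_convexHull (𝕜 := ℝ)
  have hconv : Convex ℝ P.carrier := hP ▸ convex_convexHull ℝ S
  have key : ∀ F : P.Edge, F.1 = convexHull ℝ (F.1 ∩ S) := by
    intro F
    have hF := F.2.2.1
    have hFc : IsCompact F.1 := hF.isCompact hc
    have hFconv : Convex ℝ F.1 := hF.convex hconv
    have hext : F.1.extremePoints ℝ ⊆ F.1 ∩ S := by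
      intro x hx
      refine ⟨hx.1, ?_⟩
      have h1 : x ∈ P.carrier.extremePoints ℝ := hF.isExtreme.extremePoints_subset_extremePoints hx
      rw [hP] at h1
      exact extremePoints_convexHull_subset h1
    refine Set.Subset.antisymm ?_ (convexHull_min Set.inter_subset_left hFconv)
    rw [← closure_convexHull_extremePoints hFc hFconv]
    have hfin : (F.1 ∩ S).Finite := hS.subset Set.inter_subset_right
    refine closure_minimal ?_ ?_
    · rw [closure_convexHull_extremePoints hFc hFconv]
      exact convexHull_mono hext
    · rw [closure_convexHull_extremePoints hFc hFconv]
      exact (hfin.isCompact_convexHull (𝕜 := ℝ)).isClosed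
  have : Finite (Set.powerset S) := hS.finite_subsets
  have : Finite P.Edge := by
    refine Finite.of_injective
      (fun F : P.Edge => (⟨F.1 ∩ S, Set.inter_subset_right⟩ : Set.powerset S)) ?_
    intro F G h
    have h' : F.1 ∩ S = G.1 ∩ S := congrArg Subtype.val h
    apply Subtype.ext
    rw [key F, key G, h']
  obtain ⟨n, ⟨e⟩⟩ := Finite.exists_equiv_fin P.Edge
  exact ⟨n, ⟨e.symm⟩⟩

end ConvexPolyhedron

/-- The dual code: all words orthogonal to every codeword for the standard dot product. -/
def dualCode {n : ℕ} (C : Submodule (ZMod 2) (Fin n → ZMod 2)) :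
    Submodule (ZMod 2) (Fin n → ZMod 2) where
  carrier := {y | ∀ x ∈ C, x ⬝ᵥ y = 0}
  zero_mem' := by intro x _; simp
  add_mem' := by
    intro a b ha hb x hx
    rw [dotProduct_add, ha x hx, hb x hx, add_zero]
  smul_mem' := by
    intro r a ha x hx
    rw [dotProduct_smul, ha x hx, smul_zero]

/-- Two binary codes are isomorphic if one is obtained from the other by relabelling the
coordinates. -/
def CodeIsomorphic {n m : ℕ} (C : Submodule (ZMod 2) (Fin n → ZMod 2))
    (D : Submodule (ZMod 2) (Fin m → ZMod 2)) : Prop :=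
  ∃ σ : Fin n ≃ Fin m, ∀ x : Fin m → ZMod 2, x ∈ D ↔ x ∘ σ ∈ C

/-! Over 𝔽₂ the code of Γ is the cycle space of its edge graph, and its dual turns out to be the set
of words orthogonal to every facet boundary (`mem_dualCode_iff`). Duality turns facets of Γ into
vertices of Γ' and matches edges compatibly (`exists_edge_equiv`), so this facet condition becomes
the vertex condition defining the code of Γ'.

A facet boundary is a codeword because each vertex of a facet lies on exactly two of its edges
(`exists_edges_at`). Conversely, a word orthogonal to all facets is a coboundary
(`exists_potential`), and coboundaries are orthogonal to cycles. This is the vanishing of H¹ of the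
boundary sphere, proved here by a sweep: a generic functional η orders the vertices, and the
potential is extended downwards one vertex at a time. Each ascending edge at the new vertex v
prescribes a value there. Two ascending edges of a facet whose lowest vertex is v prescribe the same
value, since the other edges of that facet are already satisfied. Such facets link all ascending
edges at v (`eq_of_edges_pos`).

The incidence facts are linear algebra on the finite set of extreme points: functionals attaining
their minimum on a face are compared through their slopes, that is, ratios of two functionals. -/

open Module

/-! ### Edges and facets of a finite point set, described by functionals -/

/-- A finite set of points in strictly convex position (every point is the unique minimiser of a
functional) which is not contained in a plane. -/
structure IsVertexSet (V : Set Space3) : Prop where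
  finite : V.Finite
  exposed : ∀ v ∈ V, ∃ p : Dual ℝ Space3, ∀ u ∈ V, u ≠ v → 0 < p (u - v)
  full : ∀ v ∈ V, ∀ k : Dual ℝ Space3, (∀ u ∈ V, k (u - v) = 0) → k = 0

/-- The two points `v` and `t` of `V` span an edge. -/
def IsEdgePair (V : Set Space3) (v t : Space3) : Prop :=
  v ∈ V ∧ t ∈ V ∧ t ≠ v ∧ ∃ k : Dual ℝ Space3, k (t - v) = 0 ∧
    ∀ u ∈ V, u ≠ v → u ≠ t → 0 < k (u - v)

/-- The points of `V` on a two-dimensional face of its convex hull. -/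
def IsFacetSet (V A : Set Space3) : Prop :=
  A.Nonempty ∧ (∃ k : Dual ℝ Space3, A = {u ∈ V | ∀ t ∈ V, k u ≤ k t}) ∧
    finrank ℝ (vectorSpan ℝ A) = 2

theorem IsEdgePair.symm {V : Set Space3} {v t : Space3} (h : IsEdgePair V v t) :
    IsEdgePair V t v := by
  obtain ⟨hv, ht, hne, k, hk, hpos⟩ := h
  refine ⟨ht, hv, hne.symm, k, ?_, fun u hu h1 h2 => ?_⟩
  · rw [← neg_sub, map_neg, hk, neg_zero]
  · have h3 := hpos u hu h2 h1
    have h4 : u - t = (u - v) - (t - v) := by abel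
    rw [h4, map_sub, hk, sub_zero]
    exact h3

/-! ### Linear algebra in three-space and its dual -/

theorem finrank_dual_space3 : finrank ℝ (Dual ℝ Space3) = 3 := by
  rw [Subspace.dual_finrank_eq]; simp

theorem finrank_span_singleton_le_one {M : Type*} [AddCommGroup M] [Module ℝ M] (x : M) :
    finrank ℝ (Submodule.span ℝ {x}) ≤ 1 := by
  simpa using finrank_span_le_card (R := ℝ) ({x} : Set M)

theorem exists_combination_of_linearIndependent {M : Type*} [AddCommGroup M] [Module ℝ M]
    [FiniteDimensional ℝ M] (h3 : finrank ℝ M = 3) {a b c : M} (h : LinearIndependent ℝ ![a, b, c]) (y : M) :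
    ∃ α β γ : ℝ, y = α • a + β • b + γ • c := by
  have hs : Submodule.span ℝ (Set.range ![a, b, c]) = ⊤ :=
    h.span_eq_top_of_card_eq_finrank' (by simp [h3])
  have hy : y ∈ Submodule.span ℝ (Set.range ![a, b, c]) := hs ▸ Submodule.mem_top
  rw [Submodule.mem_span_range_iff_exists_fun] at hy
  obtain ⟨w, hw⟩ := hy
  refine ⟨w 0, w 1, w 2, ?_⟩
  rw [← hw, Fin.sum_univ_three]
  rfl

theorem linearIndependent_triple {M : Type*} [AddCommGroup M] [Module ℝ M] {a b c : M}
    (h : ∀ α β γ : ℝ, α • a + β • b + γ • c = 0 → α = 0 ∧ β = 0 ∧ γ = 0) :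
    LinearIndependent ℝ ![a, b, c] := by
  rw [Fintype.linearIndependent_iff]
  intro g hg
  rw [Fin.sum_univ_three] at hg
  obtain ⟨h0, h1, h2⟩ := h _ _ _ hg
  intro i
  fin_cases i <;> assumption

/-- A functional vanishing on two independent vectors of three-space is unique up to scaling. -/
theorem exists_smul_eq_of_vanish {a b : Space3} (ha : a ≠ 0) (hb : ∀ c : ℝ, b ≠ c • a)
    {k m : Dual ℝ Space3} (hk : k ≠ 0) (hka : k a = 0) (hkb : k b = 0) (hma : m a = 0)
    (hmb : m b = 0) : ∃ c : ℝ, m = c • k := by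
  obtain ⟨x, hx⟩ : ∃ x, k x ≠ 0 := by
    by_contra! h
    exact hk (LinearMap.ext h)
  have hli : LinearIndependent ℝ ![a, b, x] := by
    refine linearIndependent_triple fun α β γ h => ?_
    have hγ : γ = 0 := by
      have := congrArg k h
      simpa [hka, hkb, hx] using this
    subst hγ
    have hβ : β = 0 := by
      by_contra hβ
      apply hb (-(β⁻¹ * α))
      have : β • b = -(α • a) := by
        rw [zero_smul, add_zero] at h
        exact eq_neg_of_add_eq_zero_right h
      calc b = β⁻¹ • (β • b) := by rw [smul_smul, inv_mul_cancel₀ hβ, one_smul]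
        _ = _ := by rw [this, smul_neg, smul_smul, neg_smul]
    subst hβ
    refine ⟨?_, rfl, rfl⟩
    simpa [ha] using h
  refine ⟨m x / k x, LinearMap.ext fun y => ?_⟩
  obtain ⟨α, β, γ, rfl⟩ := exists_combination_of_linearIndependent (by simp) hli y
  simp [hka, hkb, hma, hmb]
  field_simp

/-- The annihilator of a nonzero vector is a plane in the dual, so two independent members span it.
-/
theorem exists_smul_add_smul_of_vanish {d : Space3} (hd : d ≠ 0) {k m j : Dual ℝ Space3}
    (hk : k d = 0) (hm : m d = 0) (hj : j d = 0) (hk0 : k ≠ 0) (hmk : ∀ c : ℝ, m ≠ c • k) :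
    ∃ α β : ℝ, j = α • m + β • k := by
  obtain ⟨q, hq⟩ : ∃ q : Dual ℝ Space3, q d ≠ 0 := by
    by_contra! h
    exact hd ((Module.forall_dual_apply_eq_zero_iff ℝ d).1 h)
  have hli : LinearIndependent ℝ ![m, k, q] := by
    refine linearIndependent_triple fun α β γ h => ?_
    have hγ : γ = 0 := by
      have := congrArg (fun f : Dual ℝ Space3 => f d) h
      simpa [hk, hm, hq] using this
    subst hγ
    rw [zero_smul, add_zero] at h
    have hα : α = 0 := by
      by_contra hα
      apply hmk (-(α⁻¹ * β))
      have : α • m = -(β • k) := eq_neg_of_add_eq_zero_left h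
      calc m = α⁻¹ • (α • m) := by rw [smul_smul, inv_mul_cancel₀ hα, one_smul]
        _ = _ := by rw [this]; module
    subst hα
    refine ⟨rfl, ?_, rfl⟩
    simpa [hk0] using h
  obtain ⟨α, β, γ, rfl⟩ := exists_combination_of_linearIndependent finrank_dual_space3 hli j
  have hγ : γ = 0 := by simpa [hk, hm, hq] using hj
  exact ⟨α, β, by rw [hγ, zero_smul, add_zero]⟩

/-- The annihilator of one vector has dimension at least 2, so it does not fit in a line. -/
theorem exists_functional_vanish_independent {d : Space3} (k : Dual ℝ Space3) :
    ∃ m : Dual ℝ Space3, m d = 0 ∧ ∀ c : ℝ, m ≠ c • k := by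
  by_contra! h
  have h1 : finrank ℝ (LinearMap.ker (Dual.eval ℝ Space3 d)) ≤ 1 := by
    refine (Submodule.finrank_mono (t := Submodule.span ℝ {k}) ?_).trans (finrank_span_singleton_le_one k)
    intro m hm
    obtain ⟨c, rfl⟩ := h m hm
    exact Submodule.smul_mem _ _ (Submodule.mem_span_singleton_self k)
  have h2 := LinearMap.finrank_range_add_finrank_ker (Dual.eval ℝ Space3 d)
  have h3 : finrank ℝ (LinearMap.range (Dual.eval ℝ Space3 d)) ≤ 1 := by
    simpa using Submodule.finrank_le (LinearMap.range (Dual.eval ℝ Space3 d))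
  rw [finrank_dual_space3] at h2
  omega

/-! ### Collinearity, perturbation and supporting functionals -/

namespace IsVertexSet

variable {V : Set Space3}

/-- Of three distinct collinear points one lies between the others, and no functional has a strict
minimum there. The sign of `c` and its comparison with 1 decide which one is in the middle. -/
theorem eq_of_sub_eq_smul (hV : IsVertexSet V) {v a b : Space3} (hv : v ∈ V) (ha : a ∈ V)
    (hb : b ∈ V) (hav : a ≠ v) (hbv : b ≠ v) {c : ℝ} (h : b - v = c • (a - v)) : b = a := by
  by_contra hne
  obtain ⟨p, hp⟩ := hV.exposed v hv
  obtain ⟨pa, hpa⟩ := hV.exposed a ha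
  obtain ⟨pb, hpb⟩ := hV.exposed b hb
  have h1 := hp a ha hav
  have h2 := hp b hb hbv
  have h3 := hpa v hv hav.symm
  have h4 := hpa b hb hne
  have h5 := hpb v hv hbv.symm
  have h6 := hpb a ha (Ne.symm hne)
  have e0 := congrArg p h
  have ea := congrArg pa h
  have eb := congrArg pb h
  simp only [map_sub, map_smul, smul_eq_mul] at *
  have hc : 0 < c := by
    by_contra hc
    nlinarith
  rcases le_total c 1 with hc1 | hc1
  · nlinarith
  · nlinarith

/-- A large multiple of `k` dominates `g` wherever `k` is positive; finiteness of `V` gives one `N`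
for all points. -/
theorem exists_pos_add_smul (hV : IsVertexSet V) {v : Space3} (g k : Dual ℝ Space3) (s : Set Space3)
    (h : ∀ u ∈ V, u ∉ s → 0 ≤ k (u - v) ∧ (k (u - v) = 0 → 0 < g (u - v))) :
    ∃ N : ℝ, ∀ u ∈ V, u ∉ s → 0 < (g + N • k) (u - v) := by
  have : ∀ u ∈ V, ∀ᶠ N : ℝ in Filter.atTop, u ∉ s → 0 < (g + N • k) (u - v) := by
    intro u hu
    by_cases hs : u ∈ s
    · exact Filter.Eventually.of_forall fun _ h => absurd hs h
    obtain ⟨h0, h1⟩ := h u hu hs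
    rcases h0.eq_or_lt with h2 | h2
    · refine Filter.Eventually.of_forall fun N _ => ?_
      simpa [← h2] using h1 h2.symm
    · filter_upwards [Filter.eventually_gt_atTop (-g (u - v) / k (u - v))] with N hN _
      rw [div_lt_iff₀ h2] at hN
      rw [LinearMap.add_apply, LinearMap.smul_apply, smul_eq_mul]
      linarith
  exact ((Filter.eventually_all_finite hV.finite).2 this).exists

end IsVertexSet

/-- Recentres the supporting functional at `v`. It is nonzero because otherwise the planar set `A`
would be all of `V`. -/
theorem IsFacetSet.functional_at {V A : Set Space3} (hA : IsFacetSet V A) {v : Space3}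
    (hv : v ∈ A) (hV : IsVertexSet V) :
    ∃ k : Dual ℝ Space3, k ≠ 0 ∧ (∀ u ∈ V, 0 ≤ k (u - v)) ∧
      (∀ u, u ∈ A ↔ u ∈ V ∧ k (u - v) = 0) := by
  obtain ⟨-, ⟨k, hk⟩, hr⟩ := hA
  have hv' : v ∈ V ∧ ∀ t ∈ V, k v ≤ k t := by rw [hk] at hv; exact hv
  refine ⟨k, ?_, fun u hu => ?_, fun u => ?_⟩
  · rintro rfl
    have hAV : A = V := by rw [hk]; ext u; simp
    have hle : finrank ℝ (vectorSpan ℝ V) < finrank ℝ Space3 := by rw [← hAV, hr]; simp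
    have hlt : vectorSpan ℝ V < ⊤ := by
      refine lt_top_iff_ne_top.2 fun h => ?_
      rw [h, finrank_top] at hle
      exact lt_irrefl _ hle
    obtain ⟨f, hf, hf2⟩ := Submodule.exists_le_ker_of_lt_top _ hlt
    refine hf (hV.full v hv'.1 f fun u hu => ?_)
    exact hf2 (vsub_mem_vectorSpan ℝ hu hv'.1)
  · rw [map_sub]; linarith [hv'.2 u hu]
  · rw [hk, map_sub, sub_eq_zero]
    exact ⟨fun h => ⟨h.1, le_antisymm (h.2 v hv'.1) (hv'.2 u h.1)⟩,
      fun h => ⟨h.1, fun t ht => h.2 ▸ hv'.2 t ht⟩⟩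

theorem IsFacetSet.exists_independent {V A : Set Space3} (hA : IsFacetSet V A) {v : Space3}
    (hv : v ∈ A) : ∃ a ∈ A, ∃ b ∈ A, a ≠ v ∧ ∀ c : ℝ, b - v ≠ c • (a - v) := by
  have hr := hA.2.2
  rw [vectorSpan_eq_span_vsub_set_right ℝ hv] at hr
  by_contra! h
  have : ∃ x : Space3, Submodule.span ℝ ((· -ᵥ v) '' A) ≤ Submodule.span ℝ {x} := by
    by_cases ha : ∃ a ∈ A, a ≠ v
    · obtain ⟨a, ha, hav⟩ := ha
      refine ⟨a - v, Submodule.span_le.2 ?_⟩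
      rintro _ ⟨b, hb, rfl⟩
      obtain ⟨c, hc⟩ := h a ha b hb hav
      exact Submodule.mem_span_singleton.2 ⟨c, hc.symm⟩
    · push Not at ha
      refine ⟨0, Submodule.span_le.2 ?_⟩
      rintro _ ⟨b, hb, rfl⟩
      simp [ha b hb]
  obtain ⟨x, hx⟩ := this
  have := (Submodule.finrank_mono hx).trans (finrank_span_singleton_le_one x)
  omega

theorem isFacetSet_of_independent {V : Set Space3} {k : Dual ℝ Space3} (hk : k ≠ 0)
    {v a b : Space3} (hv : v ∈ V) (hpos : ∀ u ∈ V, 0 ≤ k (u - v)) (ha : a ∈ V) (hb : b ∈ V)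
    (hka : k (a - v) = 0) (hkb : k (b - v) = 0) (hav : a ≠ v) (hab : ∀ c : ℝ, b - v ≠ c • (a - v)) :
    IsFacetSet V {u ∈ V | k (u - v) = 0} := by
  set A := {u ∈ V | k (u - v) = 0} with hA
  have hvA : v ∈ A := ⟨hv, by simp⟩
  refine ⟨⟨v, hvA⟩, ⟨k, ?_⟩, ?_⟩
  · ext u
    simp only [hA, Set.mem_ofPred_eq, map_sub, sub_eq_zero] at hpos ⊢
    exact ⟨fun h => ⟨h.1, fun t ht => by linarith [hpos t ht]⟩,
      fun h => ⟨h.1, le_antisymm (h.2 v hv) (by linarith [hpos u h.1])⟩⟩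
  · refine le_antisymm ?_ ?_
    · have h1 : vectorSpan ℝ A ≤ LinearMap.ker k := by
        rw [vectorSpan_eq_span_vsub_set_right ℝ hvA]
        refine Submodule.span_le.2 ?_
        rintro _ ⟨b, hb, rfl⟩
        exact hb.2
      have h2 := Submodule.finrank_mono h1
      have h3 := Module.Dual.finrank_ker_add_one_of_ne_zero hk
      have h4 : finrank ℝ Space3 = 3 := by simp
      omega
    · have hli : LinearIndependent ℝ ![a - v, b - v] := by
        rw [LinearIndependent.pair_iff' (sub_ne_zero.2 hav)]
        exact fun c h => hab c h.symm
      have h1 := finrank_span_eq_card hli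
      rw [Fintype.card_fin] at h1
      refine h1.ge.trans ?_
      refine Submodule.finrank_mono (Submodule.span_le.2 ?_)
      rintro _ ⟨i, rfl⟩
      fin_cases i
      · exact vsub_mem_vectorSpan ℝ (show a ∈ A from ⟨ha, hka⟩) hvA
      · exact vsub_mem_vectorSpan ℝ (show b ∈ A from ⟨hb, hkb⟩) hvA

/-! ### Local structure: facets at an edge, edges at a vertex of a facet -/

namespace IsVertexSet

variable {V : Set Space3}

/-- The functionals vanishing along the edge form a pencil spanned by `k` and some `m`. Off the edge
`k` is positive, so signs in the pencil are those of affine functions of the slope `m / k`; the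
extreme slopes give the two facets. The final clause lets one leave the edge through a facet on
which a given functional rises. -/
theorem exists_facets_of_edge (hV : IsVertexSet V) {v a : Space3} (h : IsEdgePair V v a) :
    ∃ A B : Set Space3, IsFacetSet V A ∧ IsFacetSet V B ∧ v ∈ A ∧ a ∈ A ∧ v ∈ B ∧ a ∈ B ∧ A ≠ B ∧
      (∀ C, IsFacetSet V C → v ∈ C → a ∈ C → C = A ∨ C = B) ∧
      ∀ j : Dual ℝ Space3, j (a - v) = 0 → (∃ t ∈ V, 0 < j (t - v)) →
        (∃ u ∈ A, 0 < j (u - v)) ∨ ∃ u ∈ B, 0 < j (u - v) := by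
  obtain ⟨hv, ha, hav, k, hka, hpos⟩ := h
  have hd : a - v ≠ 0 := sub_ne_zero.2 hav
  obtain ⟨m, hma, hmk⟩ := exists_functional_vanish_independent (d := a - v) k
  have hm0 : m ≠ 0 := by simpa using hmk 0
  set U := V \ {v, a} with hU
  have hUfin : U.Finite := hV.finite.sdiff
  have hkU : ∀ u ∈ U, 0 < k (u - v) := fun u hu =>
    hpos u hu.1 (fun e => hu.2 (by simp [e])) (fun e => hu.2 (by simp [e]))
  have hcases : ∀ u ∈ V, u = v ∨ u = a ∨ u ∈ U := fun u hu => by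
    by_cases h1 : u = v
    · exact Or.inl h1
    by_cases h2 : u = a
    · exact Or.inr (Or.inl h2)
    · exact Or.inr (Or.inr ⟨hu, by simp [h1, h2]⟩)
  have hUne : U.Nonempty := by
    by_contra hne
    rw [Set.not_nonempty_iff_eq_empty] at hne
    refine hm0 (hV.full v hv m fun u hu => ?_)
    rcases hcases u hu with rfl | rfl | h
    · simp
    · exact hma
    · simp [hne] at h
  have hk0 : k ≠ 0 := by
    rintro rfl
    obtain ⟨u, hu⟩ := hUne
    simpa using hkU u hu
  have hind : ∀ u ∈ U, ∀ c : ℝ, u - v ≠ c • (a - v) := by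
    intro u hu c h
    have := hkU u hu
    rw [h, map_smul, hka, smul_zero] at this
    exact lt_irrefl _ this
  set σ : Space3 → ℝ := fun u => m (u - v) / k (u - v) with hσ
  have hmσ : ∀ u ∈ U, m (u - v) = σ u * k (u - v) := fun u hu =>
    (div_mul_cancel₀ _ (hkU u hu).ne').symm
  obtain ⟨x, hx, hxmin⟩ := Set.exists_min_image U σ hUfin hUne
  obtain ⟨y, hy, hymax⟩ := Set.exists_max_image U σ hUfin hUne
  -- A constant slope would make `m - σ x • k` vanish on all of `V`, contradicting fullness.
  have hlt : σ x < σ y := by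
    refine lt_of_le_of_ne (hxmin y hy) fun he => hmk (σ x) ?_
    rw [← sub_eq_zero]
    refine hV.full v hv _ fun u hu => ?_
    rw [LinearMap.sub_apply, LinearMap.smul_apply, smul_eq_mul]
    rcases hcases u hu with rfl | rfl | h
    · simp
    · simp [hma, hka]
    · rw [hmσ u h, le_antisymm (he ▸ hymax u h) (hxmin u h), sub_self]
  have hF : ∀ (α β : ℝ) (z : Space3), z ∈ U → α ≠ 0 → α * σ z + β = 0 →
      (∀ u ∈ U, 0 ≤ α * σ u + β) → IsFacetSet V {u ∈ V | (α • m + β • k) (u - v) = 0} := by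
    intro α β z hz hα hz0 hle
    refine isFacetSet_of_independent (v := v) (a := a) (b := z) ?_ hv ?_ ha hz.1 ?_ ?_ hav
      (hind z hz)
    · intro h
      apply hmk (-(α⁻¹ * β))
      have h1 : α • m = -(β • k) := eq_neg_of_add_eq_zero_left h
      calc m = α⁻¹ • (α • m) := by rw [smul_smul, inv_mul_cancel₀ hα, one_smul]
        _ = _ := by rw [h1]; module
    · intro u hu
      rcases hcases u hu with rfl | rfl | h
      · simp
      · simp [hma, hka]
      · simp only [LinearMap.add_apply, LinearMap.smul_apply, smul_eq_mul, hmσ u h]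
        nlinarith [mul_nonneg (hle u h) (hkU u h).le]
    · simp [hma, hka]
    · simp only [LinearMap.add_apply, LinearMap.smul_apply, smul_eq_mul, hmσ z hz]
      linear_combination k (z - v) * hz0
  have hval : ∀ (α β : ℝ), ∀ u ∈ U, (α • m + β • k) (u - v) = (α * σ u + β) * k (u - v) := by
    intro α β u hu
    simp only [LinearMap.add_apply, LinearMap.smul_apply, smul_eq_mul, hmσ u hu]
    ring
  refine ⟨{u ∈ V | ((1 : ℝ) • m + (-σ x) • k) (u - v) = 0},
    {u ∈ V | ((-1 : ℝ) • m + σ y • k) (u - v) = 0},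
    hF 1 (-σ x) x hx one_ne_zero (by ring) (fun u hu => by linarith [hxmin u hu]),
    hF (-1) (σ y) y hy (by norm_num) (by ring) (fun u hu => by linarith [hymax u hu]),
    ⟨hv, by simp⟩, ⟨ha, by simp [hma, hka]⟩, ⟨hv, by simp⟩, ⟨ha, by simp [hma, hka]⟩, ?_, ?_, ?_⟩
  · intro he
    have h1 : x ∈ {u ∈ V | ((-1 : ℝ) • m + σ y • k) (u - v) = 0} := by
      rw [← he]
      exact ⟨hx.1, by rw [hval _ _ x hx]; ring⟩
    have h2 := h1.2
    rw [hval _ _ x hx] at h2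
    nlinarith [hkU x hx]
  · intro C hC hvC haC
    obtain ⟨j, hj0, hjpos, hjC⟩ := hC.functional_at hvC hV
    obtain ⟨α, β, hj⟩ := exists_smul_add_smul_of_vanish hd hka hma ((hjC a).1 haC).2 hk0 hmk
    obtain ⟨u, huC, huU⟩ : ∃ u ∈ C, u ∈ U := by
      obtain ⟨b, hb, c, hc, hbv, hbc⟩ := hC.exists_independent hvC
      have hcv : c ≠ v := by rintro rfl; exact hbc 0 (by simp)
      have hcb : c ≠ b := by rintro rfl; exact hbc 1 (by simp)
      rcases hcases b ((hjC b).1 hb).1 with h | h | h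
      · exact absurd h hbv
      · rcases hcases c ((hjC c).1 hc).1 with h' | h' | h'
        · exact absurd h' hcv
        · exact absurd (h'.trans h.symm) hcb
        · exact ⟨c, hc, h'⟩
      · exact ⟨b, hb, h⟩
    have hu0 : α * σ u + β = 0 := by
      have := ((hjC u).1 huC).2
      rw [hj, hval α β u huU] at this
      exact (mul_eq_zero.1 this).resolve_right (hkU u huU).ne'
    have hle : ∀ w ∈ U, 0 ≤ α * σ w + β := by
      intro w hw
      have := hjpos w hw.1
      rw [hj, hval α β w hw] at this
      exact nonneg_of_mul_nonneg_left this (hkU w hw)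
    have hset : ∀ (γ : ℝ) (n : Dual ℝ Space3), γ ≠ 0 → j = γ • n →
        C = {u ∈ V | n (u - v) = 0} := by
      intro γ n hγ hn
      ext w
      rw [hjC w, hn]
      simp [hγ]
    rcases lt_trichotomy α 0 with hα | hα | hα
    · right
      refine hset (-α) _ (by linarith) ?_
      have h1 : α * σ y + β = 0 := le_antisymm (by nlinarith [hymax u huU]) (hle y hy)
      rw [hj, show β = -α * σ y by linarith]
      module
    · exfalso
      subst hα
      have : β = 0 := by linarith
      exact hj0 (by rw [hj, this]; simp)
    · left
      refine hset α _ hα.ne' ?_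
      have h1 : α * σ x + β = 0 := le_antisymm (by nlinarith [hxmin u huU]) (hle x hx)
      rw [hj, show β = -α * σ x by linarith]
      module
  · rintro j hja ⟨t, ht, htpos⟩
    obtain ⟨α, β, hj⟩ := exists_smul_add_smul_of_vanish hd hka hma hja hk0 hmk
    have htU : t ∈ U := by
      rcases hcases t ht with rfl | rfl | h
      · simp at htpos
      · simp [hja] at htpos
      · exact h
    have ht0 : 0 < α * σ t + β := by
      rw [hj, hval α β t htU] at htpos
      exact pos_of_mul_pos_left htpos (hkU t htU).le
    -- An affine function of the slope that is positive at `t` is also positive at the maximal or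
    -- the minimal slope, according to the sign of `α`.
    rcases le_total 0 α with hα | hα
    · refine Or.inr ⟨y, ⟨hy.1, by rw [hval _ _ y hy]; ring⟩, ?_⟩
      rw [hj, hval α β y hy]
      exact mul_pos (by nlinarith [hymax t htU]) (hkU y hy)
    · refine Or.inl ⟨x, ⟨hx.1, by rw [hval _ _ x hx]; ring⟩, ?_⟩
      rw [hj, hval α β x hx]
      exact mul_pos (by nlinarith [hxmin t htU]) (hkU x hx)

/-- In a facet `A` at a vertex `v` exposed by `p`, there are exactly two edges at `v`; they lead to
the points with extremal slope `η / p`. -/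
theorem exists_edges_of_facet (hV : IsVertexSet V) {A : Set Space3} (hA : IsFacetSet V A)
    {v : Space3} (hv : v ∈ A) {p η : Dual ℝ Space3} (hp : ∀ u ∈ V, u ≠ v → 0 < p (u - v))
    (hη : ∃ t ∈ A, ∃ s ∈ A, t ≠ v ∧ s ≠ v ∧ η (t - v) / p (t - v) ≠ η (s - v) / p (s - v)) :
    ∃ a ∈ A, ∃ b ∈ A, IsEdgePair V v a ∧ IsEdgePair V v b ∧ a ≠ b ∧
      (∀ u ∈ A, u ≠ v → η (a - v) / p (a - v) ≤ η (u - v) / p (u - v)) ∧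
      (∀ u ∈ A, u ≠ v → η (u - v) / p (u - v) ≤ η (b - v) / p (b - v)) ∧
      ∀ c ∈ A, IsEdgePair V v c → c = a ∨ c = b := by
  obtain ⟨k, hk0, hkpos, hkA⟩ := hA.functional_at hv hV
  have hvV : v ∈ V := ((hkA v).1 hv).1
  set σ : Space3 → ℝ := fun u => η (u - v) / p (u - v) with hσ
  set U := A \ {v} with hU
  have hpU : ∀ u ∈ U, 0 < p (u - v) := fun u hu => hp u ((hkA u).1 hu.1).1 hu.2
  have hησ : ∀ u ∈ U, η (u - v) = σ u * p (u - v) := fun u hu =>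
    (div_mul_cancel₀ _ (hpU u hu).ne').symm
  have hUfin : U.Finite := (hV.finite.subset fun u hu => ((hkA u).1 hu).1).sdiff
  obtain ⟨t, ht, s, hs, htv, hsv, hts⟩ := hη
  have htU : t ∈ U := ⟨ht, htv⟩
  have hsU : s ∈ U := ⟨hs, hsv⟩
  -- On the facet `k` vanishes, so every combination of `η`, `p`, `k` is `p` times an affine
  -- function of the slope.
  have hval : ∀ (α β γ : ℝ), ∀ u ∈ U,
      (α • η + β • p + γ • k) (u - v) = (α * σ u + β) * p (u - v) := by
    intro α β γ u hu
    simp only [LinearMap.add_apply, LinearMap.smul_apply, smul_eq_mul, hησ u hu,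
      ((hkA u).1 hu.1).2]
    ring
  have hli : LinearIndependent ℝ ![η, p, k] := by
    refine linearIndependent_triple fun α β γ h => ?_
    have h1 : ∀ u ∈ U, α * σ u + β = 0 := by
      intro u hu
      have := hval α β γ u hu
      rw [h, LinearMap.zero_apply] at this
      exact (mul_eq_zero.1 this.symm).resolve_right (hpU u hu).ne'
    have hα : α = 0 := by
      have h2 : α * (σ t - σ s) = 0 := by linarith [h1 t htU, h1 s hsU]
      exact (mul_eq_zero.1 h2).resolve_right (sub_ne_zero.2 hts)
    have hβ : β = 0 := by simpa [hα] using h1 t htU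
    subst hα hβ
    exact ⟨rfl, rfl, by simpa [hk0] using h⟩
  -- Equal slopes make `u - v` and `w - v` proportional under the basis `η`, `p`, `k` of the dual,
  -- and no three points are collinear.
  have hinj : ∀ u ∈ U, ∀ w ∈ U, σ u = σ w → u = w := by
    intro u hu w hw he
    have hz : p (u - v) • (w - v) - p (w - v) • (u - v) = 0 := by
      refine (Module.forall_dual_apply_eq_zero_iff ℝ _).1 fun f => ?_
      obtain ⟨α, β, γ, rfl⟩ := exists_combination_of_linearIndependent finrank_dual_space3 hli f
      rw [map_sub, map_smul, map_smul, hval _ _ _ u hu, hval _ _ _ w hw, he, smul_eq_mul,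
        smul_eq_mul]
      ring
    refine (hV.eq_of_sub_eq_smul hvV ((hkA u).1 hu.1).1 ((hkA w).1 hw.1).1 hu.2 hw.2
      (c := (p (u - v))⁻¹ * p (w - v)) ?_).symm
    rw [mul_smul, ← sub_eq_zero.1 hz, smul_smul, inv_mul_cancel₀ (hpU u hu).ne', one_smul]
  have hedge : ∀ (α β : ℝ), ∀ a ∈ U, α * σ a + β = 0 → (∀ u ∈ U, u ≠ a → 0 < α * σ u + β) →
      IsEdgePair V v a := by
    intro α β a ha ha0 hpos
    -- Adding a large multiple of `k` makes the functional positive off the facet without changing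
    -- it on the facet.
    obtain ⟨N, hN⟩ := hV.exists_pos_add_smul (v := v) (α • η + β • p) k {v, a} (by
      intro u hu hua
      simp only [Set.mem_insert_iff, Set.mem_singleton_iff, not_or] at hua
      refine ⟨hkpos u hu, fun h0 => ?_⟩
      have huU : u ∈ U := ⟨(hkA u).2 ⟨hu, h0⟩, hua.1⟩
      have := hval α β 0 u huU
      rw [zero_smul, add_zero] at this
      rw [this]
      exact mul_pos (hpos u huU hua.2) (hpU u huU))
    refine ⟨hvV, ((hkA a).1 ha.1).1, ha.2, α • η + β • p + N • k, ?_, fun u hu h1 h2 =>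
      hN u hu (by simp [h1, h2])⟩
    rw [hval _ _ _ a ha, ha0, zero_mul]
  obtain ⟨a, ha, hamin⟩ := Set.exists_min_image U σ hUfin ⟨t, htU⟩
  obtain ⟨b, hb, hbmax⟩ := Set.exists_max_image U σ hUfin ⟨t, htU⟩
  have hab : a ≠ b := by
    rintro rfl
    exact hts ((le_antisymm (hbmax t htU) (hamin t htU)).trans
      (le_antisymm (hbmax s hsU) (hamin s hsU)).symm)
  refine ⟨a, ha.1, b, hb.1, hedge 1 (-σ a) a ha (by ring) ?_, hedge (-1) (σ b) b hb (by ring) ?_,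
    hab, fun u hu h => hamin u ⟨hu, h⟩, fun u hu h => hbmax u ⟨hu, h⟩, ?_⟩
  · intro u hu hua
    have := lt_of_le_of_ne (hamin u hu) fun h => hua (hinj u hu a ha h.symm)
    linarith
  · intro u hu hub
    have := lt_of_le_of_ne (hbmax u hu) fun h => hub (hinj u hu b hb h)
    linarith
  · rintro c hc ⟨-, hcV, hcv, j, hjc, hj⟩
    have hcU : c ∈ U := ⟨hc, hcv⟩
    obtain ⟨α, β, γ, rfl⟩ := exists_combination_of_linearIndependent finrank_dual_space3 hli j
    rw [hval _ _ _ c hcU] at hjc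
    have hc0 := (mul_eq_zero.1 hjc).resolve_right (hpU c hcU).ne'
    have hpos : ∀ u ∈ U, u ≠ c → 0 < α * σ u + β := by
      intro u hu huc
      have := hj u ((hkA u).1 hu.1).1 hu.2 huc
      rw [hval _ _ _ u hu] at this
      exact pos_of_mul_pos_left this (hpU u hu).le
    -- An affine function of the slope cannot vanish at `c` and be positive at both extreme slopes.
    by_contra! hne
    have h1 := hpos a ha hne.1.symm
    have h2 := hpos b hb hne.2.symm
    have h3 := hamin c hcU
    have h4 := hbmax c hcU
    rcases le_total 0 α with hα | hα
    · nlinarith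
    · nlinarith

/-- If all slopes agreed at two points independent from `v`, every functional would see their
difference vectors as proportional. -/
theorem exists_slope_ne (hV : IsVertexSet V) {A : Set Space3} (hA : IsFacetSet V A)
    {v : Space3} (hv : v ∈ A) {p : Dual ℝ Space3} (hp : ∀ u ∈ V, u ≠ v → 0 < p (u - v)) :
    ∃ η : Dual ℝ Space3, ∃ t ∈ A, ∃ s ∈ A, t ≠ v ∧ s ≠ v ∧
      η (t - v) / p (t - v) ≠ η (s - v) / p (s - v) := by
  obtain ⟨k, hk0, hkpos, hkA⟩ := hA.functional_at hv hV
  obtain ⟨a, ha, b, hb, hav, hab⟩ := hA.exists_independent hv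
  have hbv : b ≠ v := by rintro rfl; exact hab 0 (by simp)
  have hpa := hp a ((hkA a).1 ha).1 hav
  have hpb := hp b ((hkA b).1 hb).1 hbv
  by_contra! h
  refine hab ((p (a - v))⁻¹ * p (b - v)) ?_
  rw [← sub_eq_zero]
  refine (Module.forall_dual_apply_eq_zero_iff ℝ _).1 fun f => ?_
  have := h f a ha b hb hav hbv
  rw [map_sub, map_smul, smul_eq_mul]
  field_simp at this ⊢
  linarith

theorem exists_two_edges_of_facet (hV : IsVertexSet V) {A : Set Space3} (hA : IsFacetSet V A)
    {v : Space3} (hv : v ∈ A) : ∃ a ∈ A, ∃ b ∈ A, IsEdgePair V v a ∧ IsEdgePair V v b ∧ a ≠ b ∧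
      ∀ c ∈ A, IsEdgePair V v c → c = a ∨ c = b := by
  obtain ⟨k, hk0, hkpos, hkA⟩ := hA.functional_at hv hV
  obtain ⟨p, hp⟩ := hV.exposed v ((hkA v).1 hv).1
  obtain ⟨η, hη⟩ := hV.exists_slope_ne hA hv hp
  obtain ⟨a, ha, b, hb, h1, h2, h3, -, -, h4⟩ := hV.exists_edges_of_facet hA hv hp hη
  exact ⟨a, ha, b, hb, h1, h2, h3, h4⟩

/-- The sum of the two supporting functionals exposes the intersection. A third common point would
make these functionals proportional, and the facets equal. -/
theorem isEdgePair_of_mem_facets (hV : IsVertexSet V) {A B : Set Space3} (hA : IsFacetSet V A)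
    (hB : IsFacetSet V B) (hAB : A ≠ B) {v a : Space3} (hav : a ≠ v) (hvA : v ∈ A) (hvB : v ∈ B)
    (haA : a ∈ A) (haB : a ∈ B) : IsEdgePair V v a ∧ A ∩ B = {v, a} := by
  obtain ⟨k, hk0, hkpos, hkA⟩ := hA.functional_at hvA hV
  obtain ⟨j, hj0, hjpos, hjB⟩ := hB.functional_at hvB hV
  have hvV := ((hkA v).1 hvA).1
  have haV := ((hkA a).1 haA).1
  have key : ∀ u ∈ A, u ∈ B → u = v ∨ u = a := by
    intro u huA huB
    by_contra! hne
    obtain ⟨c, rfl⟩ := exists_smul_eq_of_vanish (a := a - v) (b := u - v) (sub_ne_zero.2 hav)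
      (fun c hc => hne.2 (hV.eq_of_sub_eq_smul hvV haV ((hkA u).1 huA).1 hav hne.1 hc)) hk0
      ((hkA a).1 haA).2 ((hkA u).1 huA).2 ((hjB a).1 haB).2 ((hjB u).1 huB).2
    have hc : c ≠ 0 := by rintro rfl; simp at hj0
    exact hAB (by ext w; rw [hkA, hjB]; simp [hc])
  refine ⟨⟨hvV, haV, hav, k + j, ?_, fun u hu h1 h2 => ?_⟩, ?_⟩
  · simp [((hkA a).1 haA).2, ((hjB a).1 haB).2]
  · refine lt_of_le_of_ne (add_nonneg (hkpos u hu) (hjpos u hu)) fun h => ?_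
    have h3 : k (u - v) = 0 := by
      have := hkpos u hu; have := hjpos u hu
      rw [LinearMap.add_apply] at h; linarith
    have h4 : j (u - v) = 0 := by
      rw [LinearMap.add_apply] at h; linarith
    rcases key u ((hkA u).2 ⟨hu, h3⟩) ((hjB u).2 ⟨hu, h4⟩) with h5 | h5
    · exact h1 h5
    · exact h2 h5
  · ext u
    refine ⟨fun h => key u h.1 h.2, ?_⟩
    rintro (rfl | rfl)
    · exact ⟨hvA, hvB⟩
    · exact ⟨haA, haB⟩

/-! ### Connecting the ascending edges at a vertex -/

theorem exists_exposing_not_proportional (hV : IsVertexSet V) {v : Space3} (hv : v ∈ V)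
    {η : Dual ℝ Space3} (hη : η ≠ 0) :
    ∃ p : Dual ℝ Space3, (∀ u ∈ V, u ≠ v → 0 < p (u - v)) ∧ ∀ c : ℝ, c • p ≠ η := by
  obtain ⟨p, hp⟩ := hV.exposed v hv
  by_cases h : ∃ c : ℝ, c • p = η
  swap
  · exact ⟨p, hp, fun c hc => h ⟨c, hc⟩⟩
  obtain ⟨c, rfl⟩ := h
  obtain ⟨q, -, hq⟩ := exists_functional_vanish_independent (d := (0 : Space3)) p
  obtain ⟨N, hN⟩ := hV.exists_pos_add_smul (v := v) q p {v} fun u hu hne =>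
    ⟨(hp u hu hne).le, fun h => absurd h (hp u hu hne).ne'⟩
  refine ⟨q + N • p, fun u hu h => hN u hu h, fun d hd => ?_⟩
  have hc0 : c ≠ 0 := by rintro rfl; simp at hη
  have hd0 : d ≠ 0 := by rintro rfl; rw [zero_smul] at hd; exact hη hd.symm
  apply hq (d⁻¹ * c - N)
  calc q = d⁻¹ • (d • (q + N • p)) - N • p := by
        rw [smul_smul, inv_mul_cancel₀ hd0, one_smul]; abel
    _ = _ := by rw [hd]; module

/-- The edges at `v` on which `η` increases are connected through facets on which `η` is minimal
only at `v`. -/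
theorem eq_of_edges_pos (hV : IsVertexSet V) {v : Space3} (hv : v ∈ V) (η : Dual ℝ Space3)
    {R : Type*} (g : Space3 → R)
    (hg : ∀ A, IsFacetSet V A → v ∈ A → (∀ u ∈ A, u ≠ v → 0 < η (u - v)) → ∀ a ∈ A, ∀ b ∈ A,
      IsEdgePair V v a → IsEdgePair V v b → a ≠ b → g a = g b)
    {a b : Space3} (ha : IsEdgePair V v a) (hb : IsEdgePair V v b) (ha0 : 0 < η (a - v))
    (hb0 : 0 < η (b - v)) : g a = g b := by
  have hη : η ≠ 0 := by rintro rfl; simp at ha0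
  obtain ⟨p, hp, hpη⟩ := hV.exists_exposing_not_proportional hv hη
  set σ : Space3 → ℝ := fun u => η (u - v) / p (u - v) with hσ
  have hησ : ∀ u ∈ V, u ≠ v → η (u - v) = σ u * p (u - v) := fun u hu h =>
    (div_mul_cancel₀ _ (hp u hu h).ne').symm
  set U := {u | IsEdgePair V v u} with hU
  have hUfin : U.Finite := hV.finite.subset fun u hu => hu.2.1
  obtain ⟨z, hz, hzmax⟩ := Set.exists_max_image U σ hUfin ⟨a, ha⟩
  suffices h : ∀ u ∈ U, 0 < η (u - v) → g u = g z from (h a ha ha0).trans (h b hb hb0).symm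
  by_contra! hbad
  -- A bad edge of greatest slope: any linked edge of larger slope would again be bad.
  obtain ⟨u, ⟨hu, hu0, hgu⟩, humax⟩ := Set.exists_max_image
    {u | u ∈ U ∧ 0 < η (u - v) ∧ g u ≠ g z} σ (hUfin.subset fun u hu => hu.1) hbad
  have huV : u ∈ V := hu.2.1
  have huv : u ≠ v := hu.2.2.1
  have hσu : 0 < σ u := div_pos hu0 (hp u huV huv)
  by_cases hmax : ∃ t ∈ V, t ≠ v ∧ σ u < σ t
  · obtain ⟨t, ht, htv, hlt⟩ := hmax
    obtain ⟨A, B, hA, hB, hvA, huA, hvB, huB, -, -, hpos⟩ := hV.exists_facets_of_edge hu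
    have hval : ∀ w ∈ V, w ≠ v → (η - σ u • p) (w - v) = (σ w - σ u) * p (w - v) := by
      intro w hw hwv
      rw [LinearMap.sub_apply, LinearMap.smul_apply, hησ w hw hwv, smul_eq_mul, sub_mul]
    have key : ∀ C, IsFacetSet V C → v ∈ C → u ∈ C → (∃ w ∈ C, 0 < (η - σ u • p) (w - v)) →
        False := by
      rintro C hC hvC huC ⟨w, hwC, hw0⟩
      obtain ⟨k, -, -, hkC⟩ := hC.functional_at hvC hV
      have hwv : w ≠ v := by rintro rfl; simp at hw0
      have hwV := ((hkC w).1 hwC).1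
      have hσw : σ u < σ w := by
        rw [hval w hwV hwv] at hw0
        linarith [pos_of_mul_pos_left hw0 (hp w hwV hwv).le]
      obtain ⟨x, hx, y, hy, hvx, hvy, hxy, hmin, hmax, huniq⟩ := hV.exists_edges_of_facet hC hvC hp
        ⟨u, huC, w, hwC, huv, hwv, hσw.ne⟩
      have hwy : σ w ≤ σ y := hmax w hwC hwv
      -- The facet contains a larger slope, so `u` is its edge of least slope; hence `η` is positive
      -- on the whole facet off `v`.
      have hux : u = x := by
        refine (huniq u huC hu).resolve_right ?_
        rintro rfl
        exact absurd hσw (not_lt.2 hwy)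
      subst hux
      have hposC : ∀ w ∈ C, w ≠ v → 0 < η (w - v) := by
        intro w hw hwv
        have hwV := ((hkC w).1 hw).1
        rw [hησ w hwV hwv]
        exact mul_pos (hσu.trans_le (hmin w hw hwv)) (hp w hwV hwv)
      have h1 := hg C hC hvC hposC u huC y hy hu hvy hxy
      have h2 := humax y ⟨hvy, hposC y hy hvy.2.2.1, h1 ▸ hgu⟩
      exact absurd (hσw.trans_le hwy) (not_lt.2 h2)
    -- This functional vanishes along the edge and is positive exactly at larger slopes, so one of
    -- the two facets at the edge rises.
    rcases hpos (η - σ u • p) (by rw [hval u huV huv]; ring)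
      ⟨t, ht, by rw [hval t ht htv]; exact mul_pos (sub_pos.2 hlt) (hp t ht htv)⟩ with h | h
    · exact key A hA hvA huA h
    · exact key B hB hvB huB h
  · push Not at hmax
    have hzV : z ∈ V := hz.2.1
    have hzv : z ≠ v := hz.2.2.1
    have hzu : σ z = σ u := le_antisymm (hmax z hzV hzv) (hzmax u hu)
    have hne : u ≠ z := by rintro rfl; exact hgu rfl
    have hval : ∀ w ∈ V, w ≠ v → (σ u • p - η) (w - v) = (σ u - σ w) * p (w - v) := by
      intro w hw hwv
      rw [LinearMap.sub_apply, LinearMap.smul_apply, hησ w hw hwv, smul_eq_mul, sub_mul]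
    have hu1 : (σ u • p - η) (u - v) = 0 := by rw [hval u huV huv]; ring
    have hz1 : (σ u • p - η) (z - v) = 0 := by rw [hval z hzV hzv, hzu]; ring
    -- If `u` and `z` share the maximal slope, the points of that slope form with `v` a facet, on
    -- which `η` is a positive multiple of `p`. Non-proportionality of `p` and `η` makes its
    -- functional nonzero.
    have hF : IsFacetSet V {w ∈ V | (σ u • p - η) (w - v) = 0} := by
      refine isFacetSet_of_independent (sub_ne_zero.2 (hpη _)) hv ?_ huV hzV hu1 hz1 huv
        fun c hc => hne (hV.eq_of_sub_eq_smul hv huV hzV huv hzv hc).symm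
      intro w hw
      by_cases hwv : w = v
      · simp [hwv]
      · rw [hval w hw hwv]
        exact mul_nonneg (sub_nonneg.2 (hmax w hw hwv)) (hp w hw hwv).le
    refine hgu (hg _ hF ⟨hv, by simp⟩ ?_ u ⟨huV, hu1⟩ z ⟨hzV, hz1⟩ hu hz hne)
    rintro w ⟨hw, hw0⟩ hwv
    have : η (w - v) = σ u * p (w - v) := by
      rw [LinearMap.sub_apply, LinearMap.smul_apply, smul_eq_mul] at hw0
      linarith
    rw [this]
    exact mul_pos hσu (hp w hw hwv)

end IsVertexSet

/-! ### Faces of a polyhedron and their extreme points -/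

namespace ConvexPolyhedron

/-- The extreme points of a polyhedron. -/
def points (P : ConvexPolyhedron) : Set Space3 := P.carrier.extremePoints ℝ

variable (P : ConvexPolyhedron)

theorem isCompact_carrier : IsCompact P.carrier := by
  obtain ⟨S, hS, hP⟩ := P.exists_hull
  exact hP ▸ hS.isCompact_convexHull (𝕜 := ℝ)

theorem convex_carrier : Convex ℝ P.carrier := by
  obtain ⟨S, hS, hP⟩ := P.exists_hull
  exact hP ▸ convex_convexHull ℝ S

theorem finite_points : P.points.Finite := by
  obtain ⟨S, hS, hP⟩ := P.exists_hull
  refine hS.subset ?_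
  rw [points, hP]
  exact extremePoints_convexHull_subset

theorem points_subset : P.points ⊆ P.carrier := extremePoints_subset

/-- Krein–Milman; with finitely many extreme points the hull is already closed. Faces are thus
determined by their extreme points. -/
theorem eq_convexHull_inter_points {F : Set Space3} (hF : IsExposed ℝ P.carrier F) :
    F = convexHull ℝ (F ∩ P.points) := by
  have hFc : IsCompact F := hF.isCompact P.isCompact_carrier
  have hFconv : Convex ℝ F := hF.convex P.convex_carrier
  have hext : F.extremePoints ℝ ⊆ F ∩ P.points := fun x hx =>
    ⟨hx.1, hF.isExtreme.extremePoints_subset_extremePoints hx⟩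
  refine Set.Subset.antisymm ?_ (convexHull_min Set.inter_subset_left hFconv)
  have hfin : (F ∩ P.points).Finite := P.finite_points.subset Set.inter_subset_right
  calc F = closure (convexHull ℝ (F.extremePoints ℝ)) :=
        (closure_convexHull_extremePoints hFc hFconv).symm
    _ ⊆ convexHull ℝ (F ∩ P.points) :=
        closure_minimal (convexHull_mono hext) (hfin.isCompact_convexHull (𝕜 := ℝ)).isClosed

theorem carrier_eq : P.carrier = convexHull ℝ P.points := by
  have h := P.eq_convexHull_inter_points (IsExposed.refl (𝕜 := ℝ) P.carrier)
  rwa [Set.inter_eq_right.2 P.points_subset] at h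

theorem le_on_carrier (f : Dual ℝ Space3) {c : ℝ} (h : ∀ t ∈ P.points, c ≤ f t) :
    ∀ y ∈ P.carrier, c ≤ f y := by
  intro y hy
  rw [carrier_eq] at hy
  exact convexHull_min (s := P.points) (t := {x | c ≤ f x}) h (convex_halfSpace_ge f.isLinear c) hy

/-- Exposing functionals come from separating an extreme point from the hull of the others; fullness
comes from the interior point. -/
theorem isVertexSet_points : IsVertexSet P.points where
  finite := P.finite_points
  exposed v hv := by
    have h1 : v ∉ convexHull ℝ (P.points \ {v}) := by
      intro h
      have h2 := (P.convex_carrier.mem_extremePoints_iff_mem_sdiff_convexHull_sdiff.1 hv).2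
      exact h2 (convexHull_mono (Set.sdiff_subset_sdiff_left P.points_subset) h)
    obtain ⟨f, u, hfu, hfv⟩ := geometric_hahn_banach_point_closed (convex_convexHull ℝ _)
      ((P.finite_points.sdiff (t := {v})).isCompact_convexHull (𝕜 := ℝ)).isClosed h1
    refine ⟨f.toLinearMap, fun w hw hwv => ?_⟩
    have := hfv w (subset_convexHull ℝ _ ⟨hw, hwv⟩)
    rw [map_sub, sub_pos]
    exact hfu.trans this
  full v hv k hk := by
    have h1 : affineSpan ℝ P.points = ⊤ := by
      rw [← interior_convexHull_nonempty_iff_affineSpan_eq_top, ← carrier_eq]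
      exact P.nonempty_interior
    have h2 : vectorSpan ℝ P.points = ⊤ := by
      rw [← direction_affineSpan, h1, AffineSubspace.direction_top]
    rw [vectorSpan_eq_span_vsub_set_right ℝ hv] at h2
    have h3 : ⊤ ≤ LinearMap.ker k := by
      rw [← h2]
      refine Submodule.span_le.2 ?_
      rintro _ ⟨u, hu, rfl⟩
      exact hk u hu
    exact LinearMap.ker_eq_top.1 (top_le_iff.1 h3)

theorem finrank_vectorSpan_inter_points {F : Set Space3} (hF : IsExposed ℝ P.carrier F) :
    finrank ℝ (vectorSpan ℝ (F ∩ P.points)) = finrank ℝ (vectorSpan ℝ F) := by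
  conv_rhs => rw [P.eq_convexHull_inter_points hF]
  rw [← direction_affineSpan, ← direction_affineSpan, affineSpan_convexHull]

variable {P} in
theorem IsFace.inter_points {k : ℕ} {F : Set Space3} (hF : P.IsFace k F) :
    (F ∩ P.points).Nonempty ∧
      (∃ f : Dual ℝ Space3, F ∩ P.points = {u ∈ P.points | ∀ t ∈ P.points, f u ≤ f t}) ∧
      finrank ℝ (vectorSpan ℝ (F ∩ P.points)) = k := by
  obtain ⟨hne, hexp, hr⟩ := hF
  refine ⟨?_, ?_, (P.finrank_vectorSpan_inter_points hexp).trans hr⟩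
  · rw [P.eq_convexHull_inter_points hexp] at hne
    exact convexHull_nonempty_iff.1 hne
  · obtain ⟨l, hl⟩ := hexp hne
    -- Exposed faces maximise a functional, while facet sets minimise one.
    refine ⟨-l.toLinearMap, ?_⟩
    ext u
    constructor
    · rintro ⟨hu, huP⟩
      rw [hl] at hu
      exact ⟨huP, fun t ht => neg_le_neg (hu.2 t (P.points_subset ht))⟩
    · rintro ⟨huP, hu⟩
      refine ⟨?_, huP⟩
      rw [hl]
      exact ⟨P.points_subset huP, fun y hy => neg_le_neg_iff.1 (P.le_on_carrier _ hu y hy)⟩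

theorem exists_isFace (f : Dual ℝ Space3) {A : Set Space3} (hA : A.Nonempty)
    (hf : A = {u ∈ P.points | ∀ t ∈ P.points, f u ≤ f t}) :
    ∃ F, P.IsFace (finrank ℝ (vectorSpan ℝ A)) F ∧ F ∩ P.points = A := by
  set F := {x ∈ P.carrier | ∀ y ∈ P.carrier, f x ≤ f y} with hF
  have hexp : IsExposed ℝ P.carrier F := by
    intro _
    refine ⟨-(LinearMap.toContinuousLinearMap f), ?_⟩
    ext x
    simp [hF]
  have hFA : F ∩ P.points = A := by
    rw [hf]
    ext u
    exact ⟨fun h => ⟨h.2, fun t ht => h.1.2 t (P.points_subset ht)⟩,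
      fun h => ⟨⟨P.points_subset h.1, P.le_on_carrier f h.2⟩, h.1⟩⟩
  refine ⟨F, ⟨(hFA ▸ hA).mono Set.inter_subset_left, hexp, ?_⟩, hFA⟩
  rw [← P.finrank_vectorSpan_inter_points hexp, hFA]

variable {P} in
theorem IsFace.subset_iff {k m : ℕ} {F G : Set Space3} (hF : P.IsFace k F) (hG : P.IsFace m G) :
    F ⊆ G ↔ F ∩ P.points ⊆ G ∩ P.points := by
  refine ⟨fun h => Set.inter_subset_inter_left _ h, fun h => ?_⟩
  rw [P.eq_convexHull_inter_points hF.2.1, P.eq_convexHull_inter_points hG.2.1]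
  exact convexHull_mono h

theorem exists_vertex_eq (v : P.Vertex) : ∃ x ∈ P.points, v.1 = {x} := by
  obtain ⟨⟨x, hx⟩, -, hr⟩ := v.2.inter_points
  have h1 : vectorSpan ℝ (v.1 ∩ P.points) = ⊥ := Submodule.finrank_eq_zero.1 hr
  have h2 : (v.1 ∩ P.points).Subsingleton := (vectorSpan_eq_bot_iff_subsingleton ℝ).1 h1
  refine ⟨x, hx.2, ?_⟩
  rw [P.eq_convexHull_inter_points v.2.2.1, h2.eq_singleton_of_mem hx, convexHull_singleton]

/-- The point at a vertex. -/
noncomputable def Vertex.pt {P : ConvexPolyhedron} (v : P.Vertex) : Space3 := (P.exists_vertex_eq v).choose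

variable {P}

theorem Vertex.pt_mem (v : P.Vertex) : v.pt ∈ P.points := (P.exists_vertex_eq v).choose_spec.1

theorem Vertex.eq_singleton (v : P.Vertex) : v.1 = {v.pt} := (P.exists_vertex_eq v).choose_spec.2

theorem Vertex.subset_iff (v : P.Vertex) (F : Set Space3) : v.1 ⊆ F ↔ v.pt ∈ F := by
  rw [v.eq_singleton, Set.singleton_subset_iff]

theorem Vertex.pt_injective : Function.Injective (Vertex.pt (P := P)) := by
  intro v w h
  apply Subtype.ext
  rw [v.eq_singleton, w.eq_singleton, h]

theorem exists_vertex_pt {x : Space3} (hx : x ∈ P.points) : ∃ v : P.Vertex, v.pt = x := by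
  obtain ⟨p, hp⟩ := P.isVertexSet_points.exposed x hx
  obtain ⟨F, hF, hFA⟩ := P.exists_isFace p (Set.singleton_nonempty x) (by
    ext u
    simp only [Set.mem_singleton_iff, Set.mem_ofPred_eq]
    constructor
    · rintro rfl
      refine ⟨hx, fun t ht => ?_⟩
      by_cases h : t = u
      · rw [h]
      · have := hp t ht h
        rw [map_sub] at this
        linarith
    · rintro ⟨hu, h⟩
      by_contra hne
      have := hp u hu hne
      have := h x hx
      rw [map_sub] at *
      linarith)
  rw [vectorSpan_singleton, finrank_bot] at hF
  refine ⟨⟨F, hF⟩, ?_⟩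
  have h : Vertex.pt (P := P) ⟨F, hF⟩ ∈ F ∩ P.points :=
    ⟨(Vertex.subset_iff ⟨F, hF⟩ F).1 subset_rfl, Vertex.pt_mem _⟩
  rw [hFA] at h
  exact h

/-! ### Incidences of vertices, edges and facets -/

theorem Edge.exists_pair (e : P.Edge) :
    ∃ a b, IsEdgePair P.points a b ∧ e.1 ∩ P.points = {a, b} := by
  obtain ⟨⟨v, hv⟩, ⟨f, hf⟩, hr⟩ := e.2.inter_points
  set A := e.1 ∩ P.points with hA
  obtain ⟨a, ha, hav⟩ : ∃ a ∈ A, a ≠ v := by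
    by_contra! h
    have hs : A.Subsingleton := fun x hx y hy => (h x hx).trans (h y hy).symm
    rw [(vectorSpan_eq_bot_iff_subsingleton ℝ).2 hs, finrank_bot] at hr
    exact zero_ne_one hr
  have key : ∀ u ∈ A, u = v ∨ u = a := by
    intro u hu
    by_contra! hne
    obtain ⟨c, hc⟩ := exists_smul_eq_of_finrank_eq_one hr
      (x := ⟨a - v, vsub_mem_vectorSpan ℝ ha hv⟩)
      (fun h => hav (sub_eq_zero.1 (congrArg Subtype.val h)))
      ⟨u - v, vsub_mem_vectorSpan ℝ hu hv⟩
    exact hne.2 (P.isVertexSet_points.eq_of_sub_eq_smul hv.2 ha.2 hu.2 hav hne.1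
      (congrArg Subtype.val hc).symm)
  have hAeq : A = {v, a} := by
    ext u
    refine ⟨key u, ?_⟩
    rintro (rfl | rfl)
    · exact hv
    · exact ha
  have hmin : ∀ u, u ∈ A ↔ u ∈ P.points ∧ ∀ t ∈ P.points, f u ≤ f t := fun u => by
    rw [hf]; rfl
  refine ⟨v, a, ⟨hv.2, ha.2, hav, f, ?_, fun u hu huv hua => ?_⟩, hAeq⟩
  · rw [map_sub, sub_eq_zero]
    exact le_antisymm (((hmin a).1 ha).2 v hv.2) (((hmin v).1 hv).2 a ha.2)
  · rw [map_sub, sub_pos]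
    refine lt_of_le_of_ne (((hmin v).1 hv).2 u hu) fun h => ?_
    rcases key u ((hmin u).2 ⟨hu, fun t ht => h ▸ ((hmin v).1 hv).2 t ht⟩) with h | h
    · exact huv h
    · exact hua h

theorem exists_edge {a b : Space3} (h : IsEdgePair P.points a b) :
    ∃ e : P.Edge, e.1 ∩ P.points = {a, b} := by
  obtain ⟨ha, hb, hba, f, hfb, hf⟩ := h
  have hf' : ∀ u ∈ P.points, f a ≤ f u ∧ (f u = f a → u = a ∨ u = b) := by
    intro u hu
    rw [map_sub, sub_eq_zero] at hfb
    by_cases h1 : u = a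
    · simp [h1]
    by_cases h2 : u = b
    · simp [h2, hfb]
    have := hf u hu h1 h2
    rw [map_sub] at this
    exact ⟨by linarith, fun h => by linarith⟩
  obtain ⟨F, hF, hFA⟩ := P.exists_isFace f (Set.insert_nonempty a {b}) (by
    rw [map_sub, sub_eq_zero] at hfb
    ext u
    simp only [Set.mem_insert_iff, Set.mem_singleton_iff, Set.mem_ofPred_eq]
    constructor
    · rintro (rfl | rfl)
      · exact ⟨ha, fun t ht => (hf' t ht).1⟩
      · exact ⟨hb, fun t ht => hfb ▸ (hf' t ht).1⟩
    · rintro ⟨hu, h⟩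
      exact (hf' u hu).2 (le_antisymm (h a ha) (hf' u hu).1))
  have hr : finrank ℝ (vectorSpan ℝ ({a, b} : Set Space3)) = 1 := by
    rw [vectorSpan_eq_span_vsub_set_right ℝ (Set.mem_insert a {b}), Set.image_pair, vsub_self,
      Submodule.span_insert_zero, finrank_span_singleton]
    exact sub_ne_zero.2 hba
  rw [hr] at hF
  exact ⟨⟨F, hF⟩, hFA⟩

theorem Facet.isFacetSet (F : P.Facet) : IsFacetSet P.points (F.1 ∩ P.points) := F.2.inter_points

theorem exists_facet {A : Set Space3} (h : IsFacetSet P.points A) :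
    ∃ F : P.Facet, F.1 ∩ P.points = A := by
  obtain ⟨hne, ⟨f, hf⟩, hr⟩ := h
  obtain ⟨F, hF, hFA⟩ := P.exists_isFace f hne hf
  rw [hr] at hF
  exact ⟨⟨F, hF⟩, hFA⟩

theorem Vertex.subset_iff_inter (v : P.Vertex) (F : Set Space3) :
    v.1 ⊆ F ↔ v.pt ∈ F ∩ P.points := by
  rw [v.subset_iff, Set.mem_inter_iff, and_iff_left v.pt_mem]

theorem Edge.ext_inter {e e' : P.Edge} (h : e.1 ∩ P.points = e'.1 ∩ P.points) : e = e' :=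
  Subtype.ext (Set.Subset.antisymm ((e.2.subset_iff e'.2).2 h.le) ((e'.2.subset_iff e.2).2 h.ge))

theorem Facet.ext_inter {F G : P.Facet} (h : F.1 ∩ P.points = G.1 ∩ P.points) : F = G :=
  Subtype.ext (Set.Subset.antisymm ((F.2.subset_iff G.2).2 h.le) ((G.2.subset_iff F.2).2 h.ge))

/-- An edge has exactly two vertices. -/
theorem Edge.exists_vertices (e : P.Edge) : ∃ v w : P.Vertex, v ≠ w ∧
    IsEdgePair P.points v.pt w.pt ∧ e.1 ∩ P.points = {v.pt, w.pt} ∧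
      ∀ u : P.Vertex, u.1 ⊆ e.1 ↔ u = v ∨ u = w := by
  obtain ⟨a, b, hab, he⟩ := e.exists_pair
  obtain ⟨v, rfl⟩ := exists_vertex_pt hab.1
  obtain ⟨w, rfl⟩ := exists_vertex_pt hab.2.1
  refine ⟨v, w, fun h => hab.2.2.1 (h ▸ rfl), hab, he, fun u => ?_⟩
  rw [u.subset_iff_inter, he]
  simp [Vertex.pt_injective.eq_iff]

/-- An edge lies in exactly two facets. -/
theorem Edge.exists_facets (e : P.Edge) : ∃ F G : P.Facet, F ≠ G ∧
    ∀ H : P.Facet, e.1 ⊆ H.1 ↔ H = F ∨ H = G := by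
  obtain ⟨a, b, hab, he⟩ := e.exists_pair
  obtain ⟨A, B, hA, hB, haA, hbA, haB, hbB, hne, huniq, -⟩ :=
    P.isVertexSet_points.exists_facets_of_edge hab
  obtain ⟨F, rfl⟩ := exists_facet hA
  obtain ⟨G, rfl⟩ := exists_facet hB
  refine ⟨F, G, fun h => hne (h ▸ rfl), fun H => ?_⟩
  rw [e.2.subset_iff H.2, he]
  constructor
  · intro h
    rcases huniq _ H.isFacetSet (h (by simp)) (h (by simp)) with h | h
    · exact Or.inl (Facet.ext_inter h)
    · exact Or.inr (Facet.ext_inter h)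
  · rintro (rfl | rfl)
    · exact Set.insert_subset haA (Set.singleton_subset_iff.2 hbA)
    · exact Set.insert_subset haB (Set.singleton_subset_iff.2 hbB)

/-- Two facets with two common vertices meet in an edge through these vertices. -/
theorem exists_edge_of_common {F G : P.Facet} (hFG : F ≠ G) {v w : P.Vertex} (hvw : v ≠ w)
    (hvF : v.1 ⊆ F.1) (hvG : v.1 ⊆ G.1) (hwF : w.1 ⊆ F.1) (hwG : w.1 ⊆ G.1) :
    ∃ e : P.Edge, e.1 ⊆ F.1 ∧ e.1 ⊆ G.1 ∧ v.1 ⊆ e.1 ∧ w.1 ⊆ e.1 := by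
  rw [Vertex.subset_iff_inter] at hvF hvG hwF hwG
  obtain ⟨h1, h2⟩ := P.isVertexSet_points.isEdgePair_of_mem_facets F.isFacetSet G.isFacetSet
    (fun h => hFG (Facet.ext_inter h)) (fun h => hvw (Vertex.pt_injective h).symm)
    hvF hvG hwF hwG
  obtain ⟨e, he⟩ := exists_edge h1
  refine ⟨e, (e.2.subset_iff F.2).2 ?_, (e.2.subset_iff G.2).2 ?_, ?_, ?_⟩
  · rw [he, ← h2]; exact Set.inter_subset_left
  · rw [he, ← h2]; exact Set.inter_subset_right
  · rw [Vertex.subset_iff_inter, he]; simp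
  · rw [Vertex.subset_iff_inter, he]; simp

theorem Edge.eq_of_vertices {e e' : P.Edge} {v w : P.Vertex} (hvw : v ≠ w) (h1 : v.1 ⊆ e.1)
    (h2 : w.1 ⊆ e.1) (h3 : v.1 ⊆ e'.1) (h4 : w.1 ⊆ e'.1) : e = e' := by
  have key : ∀ f : P.Edge, v.1 ⊆ f.1 → w.1 ⊆ f.1 → f.1 ∩ P.points = {v.pt, w.pt} := by
    intro f hv hw
    obtain ⟨a, b, hab, -, hf, hiff⟩ := f.exists_vertices
    rw [hf]
    rcases (hiff v).1 hv with rfl | rfl <;> rcases (hiff w).1 hw with rfl | rfl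
    · exact absurd rfl hvw
    · rfl
    · exact Set.pair_comm _ _
    · exact absurd rfl hvw
  exact Edge.ext_inter ((key e h1 h2).trans (key e' h3 h4).symm)

/-- Distinct facets sharing two vertices have only those extreme points in common, so both edges
have the same endpoints. -/
theorem Edge.eq_of_facets {e e' : P.Edge} {F G : P.Facet} (hFG : F ≠ G) (h1 : e.1 ⊆ F.1)
    (h2 : e.1 ⊆ G.1) (h3 : e'.1 ⊆ F.1) (h4 : e'.1 ⊆ G.1) : e = e' := by
  obtain ⟨v, w, hvw, -, -, hiff⟩ := e.exists_vertices
  obtain ⟨v', w', hvw', -, -, hiff'⟩ := e'.exists_vertices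
  have hv := (hiff v).2 (Or.inl rfl)
  have hw := (hiff w).2 (Or.inr rfl)
  have key := (P.isVertexSet_points.isEdgePair_of_mem_facets F.isFacetSet G.isFacetSet
    (fun h => hFG (Facet.ext_inter h)) (fun h => hvw (Vertex.pt_injective h).symm)
    ((v.subset_iff_inter _).1 (hv.trans h1)) ((v.subset_iff_inter _).1 (hv.trans h2))
    ((w.subset_iff_inter _).1 (hw.trans h1)) ((w.subset_iff_inter _).1 (hw.trans h2))).2
  have hmem : ∀ u : P.Vertex, u.1 ⊆ e'.1 → u.1 ⊆ e.1 := by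
    intro u hu
    have h : u.pt ∈ ({v.pt, w.pt} : Set Space3) := by
      rw [← key]
      exact ⟨(u.subset_iff_inter _).1 (hu.trans h3), (u.subset_iff_inter _).1 (hu.trans h4)⟩
    rw [hiff]
    simpa [Vertex.pt_injective.eq_iff] using h
  have hv' := (hiff' v').2 (Or.inl rfl)
  have hw' := (hiff' w').2 (Or.inr rfl)
  exact Edge.eq_of_vertices hvw' (hmem _ hv') (hmem _ hw') hv' hw'

/-- At each of its vertices, a facet has exactly two edges. -/
theorem exists_edges_at {v : P.Vertex} {F : P.Facet} (hvF : v.1 ⊆ F.1) :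
    ∃ e e' : P.Edge, e ≠ e' ∧ ∀ d : P.Edge, v.1 ⊆ d.1 ∧ d.1 ⊆ F.1 ↔ d = e ∨ d = e' := by
  obtain ⟨a, ha, b, hb, hva, hvb, hab, huniq⟩ :=
    P.isVertexSet_points.exists_two_edges_of_facet F.isFacetSet ((v.subset_iff_inter _).1 hvF)
  obtain ⟨e, he⟩ := exists_edge hva
  obtain ⟨e', he'⟩ := exists_edge hvb
  have hvF' := (v.subset_iff_inter _).1 hvF
  refine ⟨e, e', ?_, fun d => ⟨?_, ?_⟩⟩
  · rintro rfl
    have h : b ∈ ({v.pt, a} : Set Space3) := by rw [← he, he']; simp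
    rcases h with h | h
    · exact hvb.2.2.1 h
    · exact hab h.symm
  · rintro ⟨hd, hdF⟩
    obtain ⟨x, y, hxy, hpair, hdxy, hiff⟩ := d.exists_vertices
    have : ∃ z, IsEdgePair P.points v.pt z ∧ d.1 ∩ P.points = {v.pt, z} := by
      rcases (hiff v).1 hd with rfl | rfl
      · exact ⟨_, hpair, hdxy⟩
      · exact ⟨_, hpair.symm, hdxy.trans (Set.pair_comm _ _)⟩
    obtain ⟨z, hz, hdz⟩ := this
    have hzF : z ∈ F.1 ∩ P.points := (d.2.subset_iff F.2).1 hdF (by rw [hdz]; simp)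
    rcases huniq z hzF hz with rfl | rfl
    · exact Or.inl (Edge.ext_inter (hdz.trans he.symm))
    · exact Or.inr (Edge.ext_inter (hdz.trans he'.symm))
  · rintro (rfl | rfl)
    · refine ⟨(v.subset_iff_inter _).2 (by rw [he]; simp), (d.2.subset_iff F.2).2 ?_⟩
      rw [he]
      exact Set.insert_subset hvF' (Set.singleton_subset_iff.2 ha)
    · refine ⟨(v.subset_iff_inter _).2 (by rw [he']; simp), (d.2.subset_iff F.2).2 ?_⟩
      rw [he']
      exact Set.insert_subset hvF' (Set.singleton_subset_iff.2 hb)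

/-! ### Generic height functions and ascending edges -/

theorem exists_injective_functional (P : ConvexPolyhedron) :
    ∃ η : Dual ℝ Space3, Function.Injective fun v : P.Vertex => η v.pt := by
  have : Finite P.points := P.finite_points
  obtain ⟨η, hη⟩ := Module.exists_dual_forall_apply_ne_zero (K := ℝ)
    (fun i : {i : P.points × P.points // i.1 ≠ i.2} => (i.1.1 : Space3) - i.1.2)
    (fun i h => i.2 (Subtype.ext (sub_eq_zero.1 h)))
  refine ⟨η, fun v w h => ?_⟩
  by_contra hne
  refine hη ⟨(⟨v.pt, v.pt_mem⟩, ⟨w.pt, w.pt_mem⟩), fun h => hne (Vertex.pt_injective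
    (congrArg Subtype.val h))⟩ ?_
  rw [map_sub]
  exact sub_eq_zero.2 h

/-- Transfers `eq_of_edges_pos` from points to edges: an edge at `v` is identified with its other
endpoint. -/
theorem eq_of_ascending_edges (η : Dual ℝ Space3) {R : Type*} (v : P.Vertex) (g : P.Edge → R)
    (hg : ∀ F : P.Facet, v.1 ⊆ F.1 → (∀ w : P.Vertex, w.1 ⊆ F.1 → w ≠ v → η v.pt < η w.pt) →
      ∀ e e' : P.Edge, e ≠ e' → v.1 ⊆ e.1 → v.1 ⊆ e'.1 → e.1 ⊆ F.1 → e'.1 ⊆ F.1 → g e = g e')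
    {e e' : P.Edge} (he : v.1 ⊆ e.1) (he' : v.1 ⊆ e'.1)
    (h : ∀ w : P.Vertex, w.1 ⊆ e.1 → w ≠ v → η v.pt < η w.pt)
    (h' : ∀ w : P.Vertex, w.1 ⊆ e'.1 → w ≠ v → η v.pt < η w.pt) : g e = g e' := by
  classical
  have hother : ∀ d : P.Edge, v.1 ⊆ d.1 → ∃ w : P.Vertex, w ≠ v ∧ w.1 ⊆ d.1 ∧
      IsEdgePair P.points v.pt w.pt := by
    intro d hd
    obtain ⟨x, y, hxy, hpair, -, hiff⟩ := d.exists_vertices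
    rcases (hiff v).1 hd with rfl | rfl
    · exact ⟨y, hxy.symm, (hiff y).2 (Or.inr rfl), hpair⟩
    · exact ⟨x, hxy, (hiff x).2 (Or.inl rfl), hpair.symm⟩
  obtain ⟨w, hwv, hwe, hvw⟩ := hother e he
  obtain ⟨w', hwv', hwe', hvw'⟩ := hother e' he'
  -- The default value `g e` is never used: only other endpoints of edges at `v` matter.
  let G : Space3 → R := fun x =>
    if hx : ∃ (d : P.Edge) (u : P.Vertex), u.pt = x ∧ u ≠ v ∧ v.1 ⊆ d.1 ∧ u.1 ⊆ d.1 then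
      g hx.choose else g e
  have hG : ∀ (d : P.Edge) (u : P.Vertex), u ≠ v → v.1 ⊆ d.1 → u.1 ⊆ d.1 → G u.pt = g d := by
    intro d u huv hvd hud
    have hx : ∃ (d : P.Edge) (u' : P.Vertex), u'.pt = u.pt ∧ u' ≠ v ∧ v.1 ⊆ d.1 ∧ u'.1 ⊆ d.1 :=
      ⟨d, u, rfl, huv, hvd, hud⟩
    obtain ⟨u', hu', -, h1, h2⟩ := hx.choose_spec
    obtain rfl := Vertex.pt_injective hu'
    simp only [G, dif_pos hx]
    rw [Edge.eq_of_vertices huv h2 h1 hud hvd]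
  rw [← hG e w hwv he hwe, ← hG e' w' hwv' he' hwe']
  refine P.isVertexSet_points.eq_of_edges_pos v.pt_mem η G ?_ hvw hvw'
    (by rw [map_sub, sub_pos]; exact h w hwe hwv) (by rw [map_sub, sub_pos]; exact h' w' hwe' hwv')
  intro A hA hvA hpos a ha b hb hva hvb hab
  obtain ⟨F, rfl⟩ := exists_facet hA
  obtain ⟨x, rfl⟩ := exists_vertex_pt hva.2.1
  obtain ⟨y, rfl⟩ := exists_vertex_pt hvb.2.1
  obtain ⟨d, hd⟩ := exists_edge hva
  obtain ⟨d', hd'⟩ := exists_edge hvb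
  have hxv : x ≠ v := fun h => hva.2.2.1 (h ▸ rfl)
  have hyv : y ≠ v := fun h => hvb.2.2.1 (h ▸ rfl)
  have m1 : v.1 ⊆ d.1 := (v.subset_iff_inter _).2 (by rw [hd]; simp)
  have m2 : x.1 ⊆ d.1 := (x.subset_iff_inter _).2 (by rw [hd]; simp)
  have m3 : v.1 ⊆ d'.1 := (v.subset_iff_inter _).2 (by rw [hd']; simp)
  have m4 : y.1 ⊆ d'.1 := (y.subset_iff_inter _).2 (by rw [hd']; simp)
  rw [hG d x hxv m1 m2, hG d' y hyv m3 m4]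
  refine hg F ((v.subset_iff_inter _).2 hvA) (fun u hu huv => ?_) d d' ?_ m1 m3
    ((d.2.subset_iff F.2).2 ?_) ((d'.2.subset_iff F.2).2 ?_)
  · have := hpos u.pt ((u.subset_iff_inter _).1 hu) fun h => huv (Vertex.pt_injective h)
    rwa [map_sub, sub_pos] at this
  · rintro rfl
    have h : y.pt ∈ ({v.pt, x.pt} : Set Space3) := by rw [← hd, hd']; simp
    rcases h with h | h
    · exact hvb.2.2.1 h
    · exact hab h.symm
  · rw [hd]; exact Set.insert_subset hvA (Set.singleton_subset_iff.2 ha)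
  · rw [hd']; exact Set.insert_subset hvA (Set.singleton_subset_iff.2 hb)

end ConvexPolyhedron

/-! ### Coboundaries and the dual code -/

namespace ConvexPolyhedron

variable {P : ConvexPolyhedron}

theorem Edge.subset_iff_of_vertices {e : P.Edge} {v w : P.Vertex} (hvw : v ≠ w)
    (hv : v.1 ⊆ e.1) (hw : w.1 ⊆ e.1) (u : P.Vertex) : u.1 ⊆ e.1 ↔ u = v ∨ u = w := by
  obtain ⟨a, b, hab, -, -, hiff⟩ := e.exists_vertices
  rw [hiff]
  rcases (hiff v).1 hv with rfl | rfl <;> rcases (hiff w).1 hw with rfl | rfl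
  · exact absurd rfl hvw
  · rfl
  · exact or_comm
  · exact absurd rfl hvw

instance : Finite P.Vertex :=
  have : Finite P.points := P.finite_points
  Finite.of_injective (fun v : P.Vertex => (⟨v.pt, v.pt_mem⟩ : P.points)) fun _ _ h =>
    Vertex.pt_injective (congrArg Subtype.val h)

instance : Finite P.Edge := by
  obtain ⟨n, ⟨l⟩⟩ := P.exists_labelling
  exact Finite.of_equiv _ l

open Classical in
theorem sum_edges_at_eq_zero [Fintype P.Edge] (v : P.Vertex) (F : P.Facet) (c : ZMod 2) :
    ∑ e : P.Edge with v.1 ⊆ e.1 ∧ e.1 ⊆ F.1, c = 0 := by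
  by_cases h : v.1 ⊆ F.1
  · obtain ⟨e, e', hne, hiff⟩ := exists_edges_at h
    have : (Finset.univ.filter fun d : P.Edge => v.1 ⊆ d.1 ∧ d.1 ⊆ F.1) = {e, e'} := by
      ext d
      simp [hiff]
    rw [this, Finset.sum_pair hne, CharTwo.add_self_eq_zero]
  · rw [Finset.filter_false_of_mem, Finset.sum_empty]
    exact fun e _ he => h (he.1.trans he.2)

open Classical in
/-- A word orthogonal to all facets is a coboundary. -/
theorem exists_potential [Fintype P.Vertex] [Fintype P.Edge] (x : P.Edge → ZMod 2)
    (hx : ∀ F : P.Facet, ∑ e : P.Edge with e.1 ⊆ F.1, x e = 0) :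
    ∃ f : P.Vertex → ZMod 2, ∀ e : P.Edge, ∑ v : P.Vertex with v.1 ⊆ e.1, f v = x e := by
  obtain ⟨η, hη⟩ := P.exists_injective_functional
  -- Sweep over sets `L` closed upwards under `η`, asking only for the edges with all endpoints in
  -- `L`.
  suffices h : ∀ (n : ℕ) (L : Finset P.Vertex), L.card = n →
      (∀ v ∈ L, ∀ w : P.Vertex, η v.pt < η w.pt → w ∈ L) →
      ∃ f : P.Vertex → ZMod 2, ∀ e : P.Edge, (∀ v : P.Vertex, v.1 ⊆ e.1 → v ∈ L) →
        ∑ v : P.Vertex with v.1 ⊆ e.1, f v = x e by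
    obtain ⟨f, hf⟩ := h _ Finset.univ rfl fun _ _ _ _ => Finset.mem_univ _
    exact ⟨f, fun e => hf e fun _ _ => Finset.mem_univ _⟩
  intro n
  induction n with
  | zero =>
    intro L hL _
    refine ⟨0, fun e he => ?_⟩
    obtain ⟨v, w, -, -, -, hiff⟩ := e.exists_vertices
    have := he v ((hiff v).2 (Or.inl rfl))
    rw [Finset.card_eq_zero.1 hL] at this
    simp at this
  | succ n ih =>
    intro L hL hup
    obtain ⟨v, hvL, hmin⟩ := Finset.exists_min_image L (fun v => η v.pt)
      (Finset.card_pos.1 (by omega))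
    have hlt : ∀ w ∈ L, w ≠ v → η v.pt < η w.pt := fun w hw hwv =>
      lt_of_le_of_ne (hmin w hw) fun h => hwv (hη h.symm)
    obtain ⟨f, hf⟩ := ih (L.erase v) (by rw [Finset.card_erase_of_mem hvL]; omega) (by
      intro w hw u hwu
      have hwL := Finset.mem_of_mem_erase hw
      refine Finset.mem_erase.2 ⟨?_, hup w hwL u hwu⟩
      rintro rfl
      exact absurd hwu (not_lt.2 (hmin w hwL)))
    -- For an edge at `v` this is the value it prescribes at `v`; for an edge off `v` it is the
    -- defect of `f`.
    set g : P.Edge → ZMod 2 := fun e => x e + ∑ w : P.Vertex with w ≠ v ∧ w.1 ⊆ e.1, f w with hg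
    have hfacet : ∀ F : P.Facet, v.1 ⊆ F.1 →
        (∀ w : P.Vertex, w.1 ⊆ F.1 → w ≠ v → η v.pt < η w.pt) → ∀ e e' : P.Edge, e ≠ e' →
        v.1 ⊆ e.1 → v.1 ⊆ e'.1 → e.1 ⊆ F.1 → e'.1 ⊆ F.1 → g e = g e' := by
      intro F hvF hF e e' hne he he' heF heF'
      -- The `x`-part vanishes by hypothesis; in the `f`-part every vertex is counted on both of its
      -- edges in `F`.
      have h1 : ∑ d : P.Edge with d.1 ⊆ F.1, g d = 0 := by
        rw [Finset.sum_add_distrib, hx F, zero_add,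
          Finset.sum_comm' (t' := Finset.univ.filter fun w : P.Vertex => w ≠ v)
            (s' := fun w => Finset.univ.filter fun d : P.Edge => w.1 ⊆ d.1 ∧ d.1 ⊆ F.1)]
        · exact Finset.sum_eq_zero fun w _ => sum_edges_at_eq_zero w F (f w)
        · intro d w
          simp only [Finset.mem_filter, Finset.mem_univ, true_and]
          tauto
      -- Every other edge of `F` avoids `v`, hence lies above it and has zero defect by induction.
      have h2 : ∑ d : P.Edge with d.1 ⊆ F.1, g d = g e + g e' := by
        rw [← Finset.sum_pair hne]
        symm
        refine Finset.sum_subset ?_ ?_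
        · intro d hd
          rcases Finset.mem_insert.1 hd with rfl | hd
          · simpa using heF
          · rw [Finset.mem_singleton.1 hd]; simpa using heF'
        · intro d hd hdee
          have hdF : d.1 ⊆ F.1 := by simpa using hd
          have hvd : ¬ v.1 ⊆ d.1 := by
            intro hvd
            obtain ⟨a, b, hab, hiff⟩ := exists_edges_at hvF
            have h1 := (hiff e).1 ⟨he, heF⟩
            have h2 := (hiff e').1 ⟨he', heF'⟩
            have h3 := (hiff d).1 ⟨hvd, hdF⟩
            simp only [Finset.mem_insert, Finset.mem_singleton, not_or] at hdee
            grind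
          have hdL : ∀ w : P.Vertex, w.1 ⊆ d.1 → w ∈ L.erase v := by
            intro w hw
            have hwv : w ≠ v := by rintro rfl; exact hvd hw
            exact Finset.mem_erase.2 ⟨hwv, hup v hvL w (hF w (hw.trans hdF) hwv)⟩
          simp only [hg]
          rw [← hf d hdL]
          have : (Finset.univ.filter fun w : P.Vertex => w ≠ v ∧ w.1 ⊆ d.1) =
              Finset.univ.filter fun w : P.Vertex => w.1 ⊆ d.1 := by
            refine Finset.filter_congr fun w _ => ⟨fun h => h.2, fun h => ⟨?_, h⟩⟩
            rintro rfl
            exact hvd h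
          rw [this, CharTwo.add_self_eq_zero]
      exact CharTwo.add_eq_zero.1 (h2.symm.trans h1)
    obtain ⟨c, hc⟩ : ∃ c, ∀ e : P.Edge, v.1 ⊆ e.1 →
        (∀ w : P.Vertex, w.1 ⊆ e.1 → w ≠ v → η v.pt < η w.pt) → g e = c := by
      by_cases h : ∃ e : P.Edge, v.1 ⊆ e.1 ∧
          ∀ w : P.Vertex, w.1 ⊆ e.1 → w ≠ v → η v.pt < η w.pt
      · obtain ⟨e, he, he1⟩ := h
        exact ⟨g e, fun e' he' he1' => eq_of_ascending_edges η v g hfacet he' he he1' he1⟩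
      · exact ⟨0, fun e he he1 => absurd ⟨e, he, he1⟩ h⟩
    refine ⟨Function.update f v c, fun e he => ?_⟩
    have hoff : ∑ w : P.Vertex with w ≠ v ∧ w.1 ⊆ e.1, Function.update f v c w =
        ∑ w : P.Vertex with w ≠ v ∧ w.1 ⊆ e.1, f w :=
      Finset.sum_congr rfl fun w hw =>
        Function.update_of_ne (Finset.mem_filter.1 hw).2.1 _ _
    by_cases hv : v.1 ⊆ e.1
    · have hsplit : (Finset.univ.filter fun w : P.Vertex => w.1 ⊆ e.1) =
          insert v (Finset.univ.filter fun w : P.Vertex => w ≠ v ∧ w.1 ⊆ e.1) := by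
        ext w
        simp only [Finset.mem_filter, Finset.mem_univ, true_and, Finset.mem_insert]
        by_cases h : w = v
        · simp [h, hv]
        · simp [h]
      rw [hsplit, Finset.sum_insert (by simp), hoff, Function.update_self,
        ← hc e hv fun w hw => hlt w (he w hw), hg, add_assoc, CharTwo.add_self_eq_zero, add_zero]
    · have hsame : (Finset.univ.filter fun w : P.Vertex => w.1 ⊆ e.1) =
          Finset.univ.filter fun w : P.Vertex => w ≠ v ∧ w.1 ⊆ e.1 := by
        refine Finset.filter_congr fun w _ => ⟨fun h => ⟨?_, h⟩, fun h => h.2⟩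
        rintro rfl
        exact hv h
      have heL : ∀ w : P.Vertex, w.1 ⊆ e.1 → w ∈ L.erase v := fun w hw =>
        Finset.mem_erase.2 ⟨by rintro rfl; exact hv hw, he w hw⟩
      rw [hsame, hoff, ← hsame, hf e heL]

open Classical in
/-- The dual of the code of a polyhedron consists of the words orthogonal to all facets. -/
theorem mem_dualCode_iff {n : ℕ} (l : Fin n ≃ P.Edge) (y : Fin n → ZMod 2) :
    y ∈ dualCode (P.code l) ↔ ∀ F : P.Facet, ∑ i with (l i).1 ⊆ F.1, y i = 0 := by
  have := Fintype.ofFinite P.Vertex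
  have := Fintype.ofFinite P.Edge
  constructor
  · intro hy F
    -- Test against the boundary word of the facet, which is a codeword.
    have h := hy (fun i => if (l i).1 ⊆ F.1 then 1 else 0) (by
      intro v
      have h1 := sum_edges_at_eq_zero v F 1
      rw [Finset.sum_filter, ← Equiv.sum_comp l] at h1
      rw [Finset.sum_filter, ← h1]
      exact Finset.sum_congr rfl fun i _ => by split_ifs <;> tauto)
    rw [Finset.sum_filter]
    refine Eq.trans (Finset.sum_congr rfl fun i _ => ?_) h
    split_ifs with hi <;> simp [hi]
  · intro hy c hc
    obtain ⟨f, hf⟩ := exists_potential (fun e => y (l.symm e)) (by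
      intro F
      rw [← hy F, Finset.sum_filter, Finset.sum_filter, ← Equiv.sum_comp l]
      simp)
    have h1 : ∀ i, y i = ∑ v : P.Vertex with v.1 ⊆ (l i).1, f v := fun i => by simp [hf]
    calc c ⬝ᵥ y = ∑ i, ∑ v : P.Vertex with v.1 ⊆ (l i).1, f v * c i :=
          Finset.sum_congr rfl fun i _ => by rw [h1, mul_comm, Finset.sum_mul]
      _ = ∑ v : P.Vertex, ∑ i with v.1 ⊆ (l i).1, f v * c i :=
          Finset.sum_comm' fun i v => by simp
      _ = 0 := Finset.sum_eq_zero fun v _ => by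
          rw [← Finset.mul_sum]
          exact mul_eq_zero_of_right _ (hc v)

/-! ### Edges of dual polyhedra and the conclusion -/

/-- Duality of polyhedra induces a bijection between their edges. -/
theorem exists_edge_equiv {Q : ConvexPolyhedron} (φ : P.Vertex ≃ Q.Facet) (ψ : P.Facet ≃ Q.Vertex)
    (h : ∀ (v : P.Vertex) (F : P.Facet), v.1 ⊆ F.1 ↔ (ψ F).1 ⊆ (φ v).1) :
    ∃ σ : P.Edge ≃ Q.Edge, ∀ (e : P.Edge) (F : P.Facet), e.1 ⊆ F.1 ↔ (ψ F).1 ⊆ (σ e).1 := by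
  have hex : ∀ e : P.Edge, ∃ d : Q.Edge, ∀ F : P.Facet, e.1 ⊆ F.1 ↔ (ψ F).1 ⊆ d.1 := by
    intro e
    obtain ⟨F, G, hFG, hf⟩ := e.exists_facets
    obtain ⟨v, w, hvw, -, -, hv⟩ := e.exists_vertices
    have hF := (hf F).2 (Or.inl rfl)
    have hG := (hf G).2 (Or.inr rfl)
    have hv' := (hv v).2 (Or.inl rfl)
    have hw' := (hv w).2 (Or.inr rfl)
    -- The two endpoints of `e` become facets and its two facets become common vertices of these, so
    -- an edge joins them.
    obtain ⟨d, -, -, h1, h2⟩ := exists_edge_of_common (φ.injective.ne hvw) (ψ.injective.ne hFG)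
      ((h v F).1 (hv'.trans hF)) ((h w F).1 (hw'.trans hF)) ((h v G).1 (hv'.trans hG))
      ((h w G).1 (hw'.trans hG))
    refine ⟨d, fun H => ?_⟩
    rw [hf, Edge.subset_iff_of_vertices (ψ.injective.ne hFG) h1 h2, ψ.injective.eq_iff,
      ψ.injective.eq_iff]
  choose σ hσ using hex
  refine ⟨Equiv.ofBijective σ ⟨fun e e' hee => ?_, fun d => ?_⟩, hσ⟩
  · obtain ⟨F, G, hFG, hf⟩ := e.exists_facets
    have hF := (hf F).2 (Or.inl rfl)
    have hG := (hf G).2 (Or.inr rfl)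
    refine Edge.eq_of_facets hFG hF hG ((hσ e' F).2 ?_) ((hσ e' G).2 ?_)
    · rw [← hee]; exact (hσ e F).1 hF
    · rw [← hee]; exact (hσ e G).1 hG
  · obtain ⟨A, B, hAB, hf⟩ := d.exists_facets
    obtain ⟨a, b, hab, -, -, hv⟩ := d.exists_vertices
    have hA := (hf A).2 (Or.inl rfl)
    have hB := (hf B).2 (Or.inr rfl)
    have ha := (hv a).2 (Or.inl rfl)
    have hb := (hv b).2 (Or.inr rfl)
    obtain ⟨v, rfl⟩ := φ.surjective A
    obtain ⟨w, rfl⟩ := φ.surjective B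
    obtain ⟨F, rfl⟩ := ψ.surjective a
    obtain ⟨G, rfl⟩ := ψ.surjective b
    obtain ⟨e, h1, h2, -, -⟩ := exists_edge_of_common (fun h => hab (h ▸ rfl) : F ≠ G)
      (fun h => hAB (h ▸ rfl) : v ≠ w) ((h v F).2 (ha.trans hA)) ((h v G).2 (hb.trans hA))
      ((h w F).2 (ha.trans hB)) ((h w G).2 (hb.trans hB))
    exact ⟨e, Edge.eq_of_vertices hab ((hσ e F).1 h1) ((hσ e G).1 h2) ha hb⟩

end ConvexPolyhedron

theorem mainTheorem8 (Γ Γ' : ConvexPolyhedron) (hdual : Γ.IsDual Γ') {n n' : ℕ}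
    (l : Fin n ≃ Γ.Edge) (l' : Fin n' ≃ Γ'.Edge) :
    CodeIsomorphic (dualCode (Γ.code l)) (Γ'.code l') := by
  classical
  obtain ⟨φ, ψ, h⟩ := hdual
  obtain ⟨σ, hσ⟩ := ConvexPolyhedron.exists_edge_equiv φ ψ h
  refine ⟨(l.trans σ).trans l'.symm, fun x => ?_⟩
  rw [ConvexPolyhedron.mem_dualCode_iff]
  have hmem : x ∈ Γ'.code l' ↔ ∀ v : Γ'.Vertex, ∑ i with v.1 ⊆ (l' i).1, x i = 0 := by
    simp only [Finset.sum_filter]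
    refine forall_congr' fun v => ?_
    rw [Finset.sum_filter]
  rw [hmem, ← ψ.forall_congr_right]
  refine forall_congr' fun F => ?_
  rw [Finset.sum_filter, Finset.sum_filter, ← Equiv.sum_comp ((l.trans σ).trans l'.symm)]
  simp [hσ]
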